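/- Let $\tilde{\mathcal A}=\{\sum_{\nu\ge 0}P_\nu(a)\,b^\nu : P_\nu\in\mathbb C[z]\}$ be the $\mathbb C$-algebra with commutation relation $ab-ba=b^2$, in which left and right multiplication by $a$ are continuous for the $b$-adic topology. An (a,b)-module is a left $\tilde{\mathcal A}$-module that is free of finite rank over the subalgebra $\mathbb C[[b]]$. For $\lambda\in\mathbb C$ put $E_\lambda=\tilde{\mathcal A}/\tilde{\mathcal A}(a-\lambda b)$. The dual of an (a,b)-module $F$ is the (a,b)-module $F^*=\mathrm{Hom}_{\mathbb C[[b]]}(F,E_0)$ on which $S(b)$ acts as $S(-b)$ and $a$ acts by $(a\varphi)(x)=\varphi(ax)-a\varphi(x)$. For an (a,b)-module $G$ and $\mu\in\mathbb C$ let $N(G,\mu)$ be the least integer $N_0\ge 0$ such that $b^NG\subset(a-\mu b)G$ for all $N\ge N_0$. Let $F$ be an (a,b)-module and $\lambda\in\mathbb C$. Then $N(F^*,-\lambda)$ exists, and for every $N\ge N(F^*,-\lambda)$ an extension $$0\to E_\lambda\to E\to F\to 0\qquad(\ast)$$ of $\tilde{\mathcal A}$-modules (then $E$ is an (a,b)-module)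 is uniquely determined by its reduction modulo $b^N$. Precisely, for every such $N$ and every extension $(\ast)$ the reduced sequence $$0\to E_\lambda/b^NE_\lambda\to E/b^NE\to F/b^NF\to 0\qquad(\ast_N)$$ is exact; let $K_N$ be the kernel of the map that forgets $a$, $$\mathrm{Ext}^1_{\tilde{\mathcal A}}(F/b^NF,\,E_\lambda/b^NE_\lambda)\to \mathrm{Ext}^1_{\mathbb C[[b]]}(F/b^NF,\,E_\lambda/b^NE_\lambda).$$ Then the correspondence $(\ast)\mapsto(\ast_N)$ on extension classes takes values in $K_N$ and defines a $\mathbb C$-linear isomorphism $$\delta_N:\mathrm{Ext}^1_{\tilde{\mathcal A}}(F,E_\lambda)\to K_N .$$ -/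

import Mathlib

open CategoryTheory Polynomial
open scoped PowerSeries

noncomputable section

/-- The underlying space of the algebra `Ã`: the family `P : ℕ → ℂ[X]` stands for the formal
series `∑ ν, P ν (a) * b ^ ν`, polynomial in `a` and formal power series in `b`. -/
def ATilde : Type := ℕ → ℂ[X]

namespace ATilde

instance : AddCommGroup ATilde := inferInstanceAs (AddCommGroup (ℕ → ℂ[X]))

instance : Module ℂ ATilde := inferInstanceAs (Module ℂ (ℕ → ℂ[X]))

@[ext] theorem ext {x y : ATilde} (h : ∀ n, x n = y n) : x = y := funext h

@[simp] theorem zero_coeff (n : ℕ) : (0 : ATilde) n = 0 := rfl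
@[simp] theorem add_coeff (x y : ATilde) (n : ℕ) : (x + y) n = x n + y n := rfl
@[simp] theorem sub_coeff (x y : ATilde) (n : ℕ) : (x - y) n = x n - y n := rfl
@[simp] theorem smul_coeff (c : ℂ) (x : ATilde) (n : ℕ) : (c • x) n = c • x n := rfl

/-- Coefficients of `b * x`. From `a * b - b * a = b ^ 2` one gets
`b * P(a) = P(a) * b - (b * P'(a)) * b`, whence this recursion for `x = ∑ P ν (a) * b ^ ν`. -/
def bMul (x : ATilde) : ATilde
  | 0 => 0
  | n + 1 => x n - derivative (bMul x n)

/-- The product of `x = ∑ P ν (a) * b ^ ν` with `y` is `∑ P ν (a) * (b ^ ν * y)`; the coefficient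
of `b ^ n` only involves `ν ≤ n`. -/
instance : Mul ATilde where
  mul x y := fun n => ∑ i ∈ Finset.range (n + 1), x i * (bMul^[i] y) n

/-- The element `P(a) * b ^ n`. -/
def single (n : ℕ) (P : ℂ[X]) : ATilde := fun m => if m = n then P else 0

instance : One ATilde := ⟨single 0 1⟩

/-- The generator `a`. -/
def a : ATilde := single 0 X

/-- The generator `b`. -/
def b : ATilde := single 1 1

theorem mul_coeff (x y : ATilde) (n : ℕ) :
    (x * y) n = ∑ i ∈ Finset.range (n + 1), x i * (bMul^[i] y) n := rfl

@[simp] theorem bMul_coeff_zero (x : ATilde) : bMul x 0 = 0 := by simp [bMul]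
@[simp] theorem bMul_coeff_succ (x : ATilde) (n : ℕ) :
    bMul x (n + 1) = x n - derivative (bMul x n) := by simp [bMul]

theorem bMul_add (x y : ATilde) : bMul (x + y) = bMul x + bMul y := by
  ext1 n
  induction n with
  | zero => simp
  | succ n ih => simp [ih]; ring

theorem bMul_smul (c : ℂ) (x : ATilde) : bMul (c • x) = c • bMul x := by
  ext1 n
  induction n with
  | zero => simp
  | succ n ih => simp [ih, smul_sub]

theorem bMul_iter_add (i : ℕ) (x y : ATilde) :
    bMul^[i] (x + y) = bMul^[i] x + bMul^[i] y := by
  induction i generalizing x y with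
  | zero => rfl
  | succ i ih => simp [bMul_add, ih]

theorem bMul_iter_smul (i : ℕ) (c : ℂ) (x : ATilde) :
    bMul^[i] (c • x) = c • bMul^[i] x := by
  induction i generalizing x with
  | zero => rfl
  | succ i ih => simp [bMul_smul, ih]

theorem bMul_zero : bMul 0 = 0 := by simpa using bMul_smul 0 0

theorem bMul_iter_coeff_of_lt (i : ℕ) (x : ATilde) (n : ℕ) (h : n < i) : (bMul^[i] x) n = 0 := by
  induction i generalizing n with
  | zero => omega
  | succ i ih =>
    rw [Function.iterate_succ_apply']
    induction n with
    | zero => simp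
    | succ n ihn => rw [bMul_coeff_succ, ihn (by omega), ih n (by omega)]; simp

/-- Multiplication by `b` on the right. -/
def shift (x : ATilde) : ATilde
  | 0 => 0
  | n + 1 => x n

@[simp] theorem shift_coeff_zero (x : ATilde) : shift x 0 = 0 := rfl
@[simp] theorem shift_coeff_succ (x : ATilde) (n : ℕ) : shift x (n + 1) = x n := rfl

/-- The derivation `∂ / ∂a`, coefficientwise. -/
def der (x : ATilde) : ATilde := fun n => derivative (x n)

@[simp] theorem der_coeff (x : ATilde) (n : ℕ) : der x n = derivative (x n) := rfl

theorem bMul_eq (x : ATilde) : bMul x = shift x - shift (der (bMul x)) := by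
  ext1 n
  cases n <;> simp

theorem bMul_shift (x : ATilde) : bMul (shift x) = shift (bMul x) := by
  ext1 n
  induction n with
  | zero => simp
  | succ n ih => cases n <;> simp_all

theorem bMul_der (x : ATilde) : bMul (der x) = der (bMul x) := by
  ext1 n
  induction n with
  | zero => simp
  | succ n ih => simp_all

theorem bMul_iter_shift (i : ℕ) (x : ATilde) : bMul^[i] (shift x) = shift (bMul^[i] x) := by
  induction i generalizing x with
  | zero => rfl
  | succ i ih => simp [bMul_shift, ih]

theorem bMul_iter_der (i : ℕ) (x : ATilde) : bMul^[i] (der x) = der (bMul^[i] x) := by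
  induction i generalizing x with
  | zero => rfl
  | succ i ih => simp [bMul_der, ih]

protected theorem mul_add' (x y z : ATilde) : x * (y + z) = x * y + x * z := by
  ext1 n
  simp [mul_coeff, bMul_iter_add, mul_add, Finset.sum_add_distrib]

protected theorem add_mul' (x y z : ATilde) : (x + y) * z = x * z + y * z := by
  ext1 n
  simp [mul_coeff, add_mul, Finset.sum_add_distrib]

theorem sub_mul' (x y z : ATilde) : (x - y) * z = x * z - y * z := by
  rw [eq_sub_iff_add_eq, ← ATilde.add_mul', sub_add_cancel]

theorem smul_mul' (c : ℂ) (x y : ATilde) : (c • x) * y = c • (x * y) := by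
  ext1 n
  simp [mul_coeff, Finset.smul_sum]

theorem mul_smul' (c : ℂ) (x y : ATilde) : x * (c • y) = c • (x * y) := by
  ext1 n
  simp [mul_coeff, bMul_iter_smul, Finset.smul_sum]

theorem shift_mul (x y : ATilde) : shift x * y = x * bMul y := by
  ext1 n
  rw [mul_coeff, mul_coeff, Finset.sum_range_succ', Finset.sum_range_succ]
  simp only [shift_coeff_succ, Function.iterate_succ_apply, shift_coeff_zero, zero_mul, add_zero]
  rw [← Function.iterate_succ_apply, bMul_iter_coeff_of_lt _ _ _ (Nat.lt_succ_self n)]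
  simp

theorem mul_shift (x y : ATilde) : x * shift y = shift (x * y) := by
  ext1 n
  cases n with
  | zero => simp [mul_coeff]
  | succ n =>
    rw [mul_coeff, shift_coeff_succ, Finset.sum_range_succ, mul_coeff]
    rw [bMul_iter_shift, shift_coeff_succ, bMul_iter_coeff_of_lt (n + 1) y n (Nat.lt_succ_self n)]
    simp [bMul_iter_shift]

theorem der_mul (x y : ATilde) : der (x * y) = der x * y + x * der y := by
  ext1 n
  simp [mul_coeff, bMul_iter_der, Finset.sum_add_distrib]

theorem shift_add (x y : ATilde) : shift (x + y) = shift x + shift y := by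
  ext1 n
  cases n <;> simp

/-- The recursion determines `bMul`. -/
theorem eq_bMul {x w : ATilde} (h : w = shift x - shift (der w)) : w = bMul x := by
  ext1 n
  induction n with
  | zero => rw [h]; simp
  | succ n ih => rw [h]; simp [ih]

theorem bMul_mul (y z : ATilde) : bMul (y * z) = bMul y * z := by
  symm
  apply eq_bMul
  have h1 (u : ATilde) : bMul y * u = y * bMul u - der (bMul y) * bMul u := by
    conv_lhs => rw [bMul_eq y, sub_mul', shift_mul, shift_mul]
  have h2 : bMul y * der z + der (bMul y) * der (bMul z) = y * der (bMul z) := by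
    rw [h1, bMul_der, sub_add_cancel]
  have h3 : shift z = bMul z + shift (der (bMul z)) := by
    nth_rewrite 1 [bMul_eq z]
    rw [sub_add_cancel]
  have h4 : shift (y * z) = y * bMul z + shift (y * der (bMul z)) := by
    rw [← mul_shift, h3, ATilde.mul_add', mul_shift]
  have h5 : shift (der (bMul y) * z)
      = der (bMul y) * bMul z + shift (der (bMul y) * der (bMul z)) := by
    rw [← mul_shift, h3, ATilde.mul_add', mul_shift]
  rw [der_mul, shift_add, h4, h5, h1 z, ← h2, shift_add]
  abel

theorem bMul_iter_mul (i : ℕ) (y z : ATilde) : bMul^[i] (y * z) = bMul^[i] y * z := by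
  induction i generalizing y with
  | zero => rfl
  | succ i ih => simp [bMul_mul, ih]

protected theorem mul_assoc' (x y z : ATilde) : x * y * z = x * (y * z) := by
  ext1 n
  rw [mul_coeff, mul_coeff]
  simp only [bMul_iter_mul, mul_coeff, Finset.sum_mul, Finset.mul_sum]
  have h : ∀ p ∈ Finset.range (n + 1),
      ∑ i ∈ Finset.range (p + 1), x i * (bMul^[i] y) p * (bMul^[p] z) n
        = ∑ i ∈ Finset.range (n + 1), x i * (bMul^[i] y) p * (bMul^[p] z) n := by
    intro p hp
    apply Finset.sum_subset
    · intro i hi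
      simp only [Finset.mem_range] at *
      omega
    · intro i _ hi
      simp only [Finset.mem_range] at *
      rw [bMul_iter_coeff_of_lt i y p (by omega)]
      simp
  rw [Finset.sum_congr rfl h, Finset.sum_comm]
  simp only [mul_assoc]

theorem single_mul_coeff (m : ℕ) (P : ℂ[X]) (x : ATilde) (n : ℕ) :
    (single m P * x) n = P * (bMul^[m] x) n := by
  rw [mul_coeff]
  by_cases h : m ≤ n
  · rw [Finset.sum_eq_single m]
    · simp [single]
    · intro i _ hi
      simp [single, hi]
    · intro hm
      simp at hm
      omega
  · rw [bMul_iter_coeff_of_lt m x n (by omega), mul_zero]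
    apply Finset.sum_eq_zero
    intro i hi
    have : i ≠ m := by
      simp at hi
      omega
    simp [single, this]

protected theorem one_mul' (x : ATilde) : 1 * x = x := by
  ext1 n
  change (single 0 1 * x) n = x n
  simp [single_mul_coeff]

theorem bMul_iter_single (i m : ℕ) (c : ℂ) :
    bMul^[i] (single m (C c)) = single (m + i) (C c) := by
  induction i generalizing m with
  | zero => rfl
  | succ i ih =>
    have h : bMul (single m (C c)) = single (m + 1) (C c) := by
      ext1 n
      induction n with
      | zero => simp [single]
      | succ n ih =>
        rw [bMul_coeff_succ, ih]
        by_cases h : n = m <;> by_cases h' : n = m + 1 <;> simp [single, h, h']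
    rw [Function.iterate_succ_apply, h, ih]
    congr 1
    omega

protected theorem mul_one' (x : ATilde) : x * 1 = x := by
  ext1 n
  have h (i : ℕ) : bMul^[i] (1 : ATilde) = single i 1 := by
    have := bMul_iter_single i 0 1
    rw [zero_add, C_1] at this
    exact this
  rw [mul_coeff, Finset.sum_eq_single n]
  · simp [h, single]
  · intro i _ hi
    simp [h, single, hi.symm]
  · simp

instance : Ring ATilde where
  __ := (inferInstance : AddCommGroup ATilde)
  __ := (inferInstance : Mul ATilde)
  __ := (inferInstance : One ATilde)
  left_distrib := ATilde.mul_add'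
  right_distrib := ATilde.add_mul'
  zero_mul x := by ext1 n; simp [mul_coeff]
  mul_zero x := by simpa using mul_smul' 0 x 0
  mul_assoc := ATilde.mul_assoc'
  one_mul := ATilde.one_mul'
  mul_one := ATilde.mul_one'

instance : Algebra ℂ ATilde := Algebra.ofModule smul_mul' mul_smul'

theorem b_mul (x : ATilde) : b * x = bMul x := by
  ext1 n
  simp [b, single_mul_coeff]

theorem mul_b (x : ATilde) : x * b = shift x := by
  have h : b = shift 1 := by
    ext1 n
    cases n with
    | zero => rfl
    | succ n => cases n <;> rfl
  rw [h, mul_shift, mul_one]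

theorem b_pow (n : ℕ) : b ^ n = single n 1 := by
  induction n with
  | zero => rfl
  | succ n ih =>
    rw [pow_succ, mul_b, ih]
    ext1 m
    cases m <;> simp [single]

/-- The defining commutation relation. -/
theorem a_mul_b : a * b - b * a = b ^ 2 := by
  rw [mul_b, b_mul, b_pow]
  have h : bMul a = single 1 X - single 2 1 := by
    ext1 n
    induction n with
    | zero => simp [single]
    | succ n ih =>
      rw [bMul_coeff_succ, ih]
      by_cases h0 : n = 0
      · subst h0; simp [single, a]
      · by_cases h1 : n = 1
        · subst h1; simp [single, a]
        · by_cases h2 : n = 2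
          · subst h2; simp [single, a]
          · simp [single, a, h0, h1, h2]
  rw [h]
  ext1 n
  cases n <;> simp [single, a]

theorem polynomial_mul_b_pow (P : ℂ[X]) (n : ℕ) : aeval a P * b ^ n = single n P := by
  have h0 (Q : ℂ[X]) : aeval a Q = single 0 Q := by
    induction Q using Polynomial.induction_on' with
    | add p q hp hq =>
      rw [map_add, hp, hq]
      ext1 n
      by_cases h : n = 0 <;> simp [single, h]
    | monomial k c =>
      have hk : a ^ k = single 0 (X ^ k) := by
        induction k with
        | zero => rfl
        | succ k ih =>
          rw [pow_succ, ih]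
          ext1 n
          rw [single_mul_coeff]
          by_cases h : n = 0 <;> simp [single, a, h, pow_succ]
      rw [aeval_monomial, hk, ← C_mul_X_pow_eq_monomial, ← Algebra.smul_def]
      ext1 n
      by_cases h : n = 0 <;> simp [single, h, smul_eq_C_mul]
  rw [h0, b_pow]
  ext1 m
  have h1 := bMul_iter_single 0 n 1
  rw [single_mul_coeff]
  by_cases h : m = n <;> simp [single, h]

/-- The element `∑ s ν * b ^ ν` of `Ã` attached to `S = ∑ s ν * X ^ ν`. -/
def psFun (S : ℂ⟦X⟧) : ATilde := fun n => C (PowerSeries.coeff n S)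

theorem psFun_coeff (S : ℂ⟦X⟧) (n : ℕ) : psFun S n = C (PowerSeries.coeff n S) := rfl

theorem bMul_psFun (S : ℂ⟦X⟧) : bMul (psFun S) = psFun (PowerSeries.X * S) := by
  symm
  apply eq_bMul
  ext1 n
  cases n with
  | zero => simp [psFun_coeff]
  | succ n => simp [psFun_coeff, PowerSeries.coeff_succ_X_mul]

theorem bMul_iter_psFun (i : ℕ) (S : ℂ⟦X⟧) :
    bMul^[i] (psFun S) = psFun (PowerSeries.X ^ i * S) := by
  induction i generalizing S with
  | zero => simp
  | succ i ih => rw [Function.iterate_succ_apply, bMul_psFun, ih, pow_succ, mul_assoc]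

/-- The embedding of `ℂ⟦b⟧` in `Ã`. -/
def ofPowerSeries : ℂ⟦X⟧ →ₐ[ℂ] ATilde :=
  AlgHom.ofLinearMap
    { toFun := psFun
      map_add' := fun S T => by ext1 n; simp [psFun_coeff]
      map_smul' := fun c S => by ext1 n; simp [psFun_coeff, smul_eq_C_mul] }
    (by
      ext1 n
      change C (PowerSeries.coeff n (1 : ℂ⟦X⟧)) = if n = 0 then 1 else 0
      rw [PowerSeries.coeff_one]
      split_ifs <;> simp)
    (by
      intro S T
      ext1 n
      change psFun (S * T) n = (psFun S * psFun T) n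
      rw [mul_coeff, psFun_coeff, PowerSeries.coeff_mul,
        Finset.Nat.sum_antidiagonal_eq_sum_range_succ_mk, map_sum]
      refine Finset.sum_congr rfl fun i hi => ?_
      have hi' : i ≤ n := by simpa [Nat.lt_succ_iff] using hi
      simp [bMul_iter_psFun, psFun_coeff, PowerSeries.coeff_X_pow_mul', hi'])

theorem ofPowerSeries_coeff (S : ℂ⟦X⟧) (n : ℕ) :
    ofPowerSeries S n = C (PowerSeries.coeff n S) := rfl

theorem b_pow_mul_a (i : ℕ) : b ^ i * a = single i X - (i : ℂ) • single (i + 1) 1 := by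
  induction i with
  | zero =>
    ext1 n
    simp [a]
  | succ i ih =>
    rw [pow_succ', mul_assoc, ih, b_mul]
    symm
    apply eq_bMul
    ext1 n
    have hd (k : ℕ) (c : ℂ) : der (single k X - c • single (k + 1) 1) = single k 1 := by
      ext1 n
      by_cases h : n = k
      · subst h; simp [single]
      · by_cases h' : n = k + 1
        · subst h'; simp [single, smul_eq_C_mul]
        · simp [single, h, h']
    rw [hd]
    cases n with
    | zero => simp [single]
    | succ n =>
      by_cases h : n = i
      · subst h; simp [single]
      · by_cases h' : n = i + 1
        · subst h'; simp [single, add_smul]; abel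
        · simp [single, h, h']

/-- The relation `a * S(b) = S(b) * a + b ^ 2 * S'(b)`. -/
theorem a_mul_ofPowerSeries (S : ℂ⟦X⟧) :
    a * ofPowerSeries S
      = ofPowerSeries S * a + ofPowerSeries (PowerSeries.X ^ 2 * PowerSeries.derivative ℂ S) := by
  have h (i : ℕ) : bMul^[i] a = single i X - (i : ℂ) • single (i + 1) 1 := by
    rw [← b_pow_mul_a, b_pow]
    ext1 n
    rw [single_mul_coeff, one_mul]
  ext1 n
  have ha : (a * ofPowerSeries S) n = X * C (PowerSeries.coeff n S) := by
    change (single 0 X * ofPowerSeries S) n = _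
    rw [single_mul_coeff]
    rfl
  rw [ha, add_coeff, mul_coeff, Finset.sum_range_succ, ofPowerSeries_coeff, ofPowerSeries_coeff]
  have hn : (bMul^[n] a) n = X := by
    rw [h]
    simp [single]
  rw [hn]
  cases n with
  | zero => simp
  | succ n =>
    rw [Finset.sum_range_succ, ofPowerSeries_coeff]
    have hn' : (bMul^[n] a) (n + 1) = - C (n : ℂ) := by
      rw [h]
      simp [single, smul_eq_C_mul]
    rw [hn', Finset.sum_eq_zero]
    · cases n with
      | zero =>
        simp [pow_succ, mul_assoc, PowerSeries.coeff_succ_X_mul]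
      | succ n =>
        rw [show n + 1 + 1 = n + 2 from rfl, PowerSeries.coeff_X_pow_mul]
        simp [PowerSeries.coeff_derivative]
        ring
    · intro i hi
      have h1 : n + 1 ≠ i := by
        simp at hi
        omega
      have h2 : n ≠ i := by
        simp at hi
        omega
      rw [h]
      simp [single, h1, h2]

/-- The relation `b ^ N * Ã = Ã * b ^ N`, in the direction that makes `b ^ N * E` a submodule. -/
theorem exists_mul_b_pow (y : ATilde) (N : ℕ) : ∃ y' : ATilde, y * b ^ N = b ^ N * y' := by
  induction N generalizing y with
  | zero => exact ⟨y, by simp⟩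
  | succ N ih =>
    obtain ⟨z, hz⟩ := ih y
    refine ⟨z + shift (der z), ?_⟩
    have h : z * b = b * (z + shift (der z)) := by
      rw [mul_b, b_mul]
      apply eq_bMul
      ext1 n
      cases n with
      | zero => simp
      | succ n => cases n <;> simp
    rw [pow_succ, ← mul_assoc, hz, mul_assoc, h, mul_assoc]

end ATilde

open ATilde

/-- The `Ã`-submodule `b ^ N * E` of a left `Ã`-module `E`. -/
def bPowSubmodule (N : ℕ) (E : Type) [AddCommGroup E] [Module ATilde E] : Submodule ATilde E where
  carrier := {x | ∃ y : E, x = b ^ N • y}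
  add_mem' := by
    rintro _ _ ⟨x, rfl⟩ ⟨y, rfl⟩
    exact ⟨x + y, (smul_add _ _ _).symm⟩
  zero_mem' := ⟨0, (smul_zero _).symm⟩
  smul_mem' := by
    rintro c _ ⟨x, rfl⟩
    obtain ⟨c', hc⟩ := exists_mul_b_pow c N
    exact ⟨c' • x, by rw [← mul_smul, hc, mul_smul]⟩

/-- The functor `E ↦ E / b ^ N * E` on left `Ã`-modules. -/
def truncation (N : ℕ) : ModuleCat.{0} ATilde ⥤ ModuleCat.{0} ATilde where
  obj E := ModuleCat.of ATilde (E ⧸ bPowSubmodule N E)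
  map {E E'} f := ModuleCat.ofHom <| Submodule.mapQ _ (bPowSubmodule N E') f.hom <| by
    rintro _ ⟨y, rfl⟩
    exact ⟨f.hom y, map_smul _ _ _⟩
  map_id E := by
    ext x
    rfl
  map_comp f g := by
    ext x
    rfl

instance (N : ℕ) : (truncation N).PreservesZeroMorphisms where
  map_zero E E' := by
    refine ModuleCat.hom_ext (LinearMap.ext fun x => ?_)
    obtain ⟨y, rfl⟩ := Submodule.Quotient.mk_surjective _ x
    exact Submodule.Quotient.mk_zero _

/-- Restriction of scalars from `Ã` to `ℂ⟦b⟧`, forgetting the action of `a`. -/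
abbrev forgetA : ModuleCat.{0} ATilde ⥤ ModuleCat.{0} ℂ⟦X⟧ :=
  ModuleCat.restrictScalars ofPowerSeries.toRingHom

theorem forgetA_map_exact (S : ShortComplex (ModuleCat.{0} ATilde)) (h : S.Exact) :
    (S.map forgetA).Exact := by
  rw [CategoryTheory.ShortComplex.ShortExact.moduleCat_exact_iff_function_exact] at h ⊢
  exact h

instance : Limits.PreservesFiniteLimits forgetA := by
  have h := ((CategoryTheory.Functor.exact_tfae forgetA).out 1 3).mp forgetA_map_exact
  exact h.1

instance : Limits.PreservesFiniteColimits forgetA := by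
  have h := ((CategoryTheory.Functor.exact_tfae forgetA).out 1 3).mp forgetA_map_exact
  exact h.2

/-- An (a,b)-module: a left `Ã`-module that is free of finite rank over `ℂ⟦b⟧`. -/
structure IsABModule (E : ModuleCat.{0} ATilde) : Prop where
  free : Module.Free ℂ⟦X⟧ (forgetA.obj E)
  finite : Module.Finite ℂ⟦X⟧ (forgetA.obj E)

/-- The (a,b)-module `E_λ = Ã / Ã (a - λ b)`. -/
def ELam (lam : ℂ) : ModuleCat.{0} ATilde :=
  ModuleCat.of ATilde
    (ATilde ⧸ (Submodule.span ATilde {a - lam • b} : Submodule ATilde ATilde))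

/-- An action of `a` on a `ℂ⟦b⟧`-module (`X` acting as `b`): an additive map with
`a (S(b) x) = S(b) (a x) + b ^ 2 S'(b) x`. For constant `S` this is `ℂ`-linearity, for `S = b` it is
`a b - b a = b ^ 2`; for other `S` it expresses the `b`-adic continuity of `a`. -/
structure AAction (E : Type) [AddCommGroup E] [Module ℂ⟦X⟧ E] where
  a : E →+ E
  a_smul : ∀ (S : ℂ⟦X⟧) (x : E),
    a (S • x) = S • a x + (PowerSeries.X ^ 2 * PowerSeries.derivative ℂ S) • x

/-- The action of `a` on a left `Ã`-module. -/
def AAction.ofModule (E : ModuleCat.{0} ATilde) : AAction (forgetA.obj E) where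
  a := { toFun := fun x : E => ((ATilde.a • x : E))
         map_zero' := smul_zero (A := E) _
         map_add' := fun x y => smul_add (A := E) _ x y }
  a_smul S x := by
    change (ATilde.a • (ofPowerSeries S • x : E) : E)
      = (ofPowerSeries S • (ATilde.a • x : E) : E) + (ofPowerSeries _ • x : E)
    rw [← mul_smul, a_mul_ofPowerSeries, add_smul, mul_smul]

/-- The space `Hom_{a,b}(E, F)` of `ℂ⟦b⟧`-linear maps `E → F`, on which `S(b)` acts as `S(-b)`. -/
def HomAB (E F : Type) [AddCommGroup E] [Module ℂ⟦X⟧ E] [AddCommGroup F] [Module ℂ⟦X⟧ F] : Type :=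
  E →ₗ[ℂ⟦X⟧] F

section HomAB

variable {E F : Type} [AddCommGroup E] [Module ℂ⟦X⟧ E] [AddCommGroup F] [Module ℂ⟦X⟧ F]

instance : AddCommGroup (HomAB E F) := inferInstanceAs (AddCommGroup (E →ₗ[ℂ⟦X⟧] F))

instance : FunLike (HomAB E F) E F := inferInstanceAs (FunLike (E →ₗ[ℂ⟦X⟧] F) E F)

instance : Module ℂ⟦X⟧ (HomAB E F) :=
  Module.compHom (E →ₗ[ℂ⟦X⟧] F) (PowerSeries.evalNegHom : ℂ⟦X⟧ →+* ℂ⟦X⟧)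

theorem HomAB.smul_apply (S : ℂ⟦X⟧) (φ : HomAB E F) (x : E) :
    (S • φ) x = PowerSeries.evalNegHom S • φ x := rfl

theorem derivative_evalNegHom (S : ℂ⟦X⟧) :
    PowerSeries.derivative ℂ (PowerSeries.evalNegHom S)
      = - PowerSeries.evalNegHom (PowerSeries.derivative ℂ S) := by
  ext n
  simp [PowerSeries.evalNegHom, PowerSeries.coeff_derivative, PowerSeries.coeff_rescale, pow_succ]
  ring

/-- The action of `a` on `Hom_{a,b}(E, F)`: `(a φ)(x) = φ (a x) - a (φ x)`. -/
def AAction.hom (sE : AAction E) (sF : AAction F) : AAction (HomAB E F) where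
  a :=
    { toFun := fun φ =>
        ({ toFun := fun x => φ (sE.a x) - sF.a (φ x)
           map_add' := fun x y => by
             have h := LinearMap.map_add (show E →ₗ[ℂ⟦X⟧] F from φ)
             change ∀ x y, φ (x + y) = φ x + φ y at h
             rw [map_add, h, h, map_add]
             abel
           map_smul' := fun S x => by
             have h := LinearMap.map_add (show E →ₗ[ℂ⟦X⟧] F from φ)
             change ∀ x y, φ (x + y) = φ x + φ y at h
             have h' := LinearMap.map_smul (show E →ₗ[ℂ⟦X⟧] F from φ)
             change ∀ (T : ℂ⟦X⟧) x, φ (T • x) = T • φ x at h'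
             rw [sE.a_smul, h, h', h', h', sF.a_smul, RingHom.id_apply, smul_sub]
             abel } : E →ₗ[ℂ⟦X⟧] F)
      map_zero' := by
        refine LinearMap.ext fun x => ?_
        change (0 : F) - sF.a 0 = 0
        simp
      map_add' := fun φ ψ => by
        refine LinearMap.ext fun x => ?_
        change φ (sE.a x) + ψ (sE.a x) - sF.a (φ x + ψ x)
          = (φ (sE.a x) - sF.a (φ x)) + (ψ (sE.a x) - sF.a (ψ x))
        rw [map_add]
        abel }
  a_smul S φ := by
    refine LinearMap.ext fun x => ?_
    change PowerSeries.evalNegHom S • φ (sE.a x) - sF.a (PowerSeries.evalNegHom S • φ x)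
      = PowerSeries.evalNegHom S • (φ (sE.a x) - sF.a (φ x))
        + PowerSeries.evalNegHom (PowerSeries.X ^ 2 * PowerSeries.derivative ℂ S) • φ x
    rw [sF.a_smul, derivative_evalNegHom]
    simp only [map_mul, map_pow, PowerSeries.evalNegHom_X, smul_sub, neg_sq, mul_neg, neg_smul]
    abel

end HomAB

/-- The underlying `ℂ⟦b⟧`-module of the dual `E^* = Hom_{a,b}(E, E_0)`. -/
abbrev Dual (E : ModuleCat.{0} ATilde) : Type := HomAB (forgetA.obj E) (forgetA.obj (ELam 0))

/-- The action of `a` on the dual `E^*`. -/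
def dualAction (E : ModuleCat.{0} ATilde) : AAction (Dual E) :=
  (AAction.ofModule E).hom (AAction.ofModule (ELam 0))

/-- The integers `N₀` such that `b ^ N * G ⊆ (a - μ b) * G` for all `N ≥ N₀`. -/
def AAction.bounds {G : Type} [AddCommGroup G] [Module ℂ⟦X⟧ G] (s : AAction G) (μ : ℂ) : Set ℕ :=
  {N₀ | ∀ N ≥ N₀, ∀ x : G, ∃ y : G,
    (PowerSeries.X ^ N : ℂ⟦X⟧) • x = s.a y - (PowerSeries.C μ * PowerSeries.X : ℂ⟦X⟧) • y}

/-- The integer `N(G, μ)`: the least `N₀` such that `b ^ N * G ⊆ (a - μ b) * G` for all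
`N ≥ N₀`. -/
def AAction.leastBound {G : Type} [AddCommGroup G] [Module ℂ⟦X⟧ G] (s : AAction G) (μ : ℂ) : ℕ :=
  sInf (s.bounds μ)

/-- The kernel of the map `Ext¹` over `Ã` to `Ext¹` over `ℂ⟦b⟧` that forgets `a`. -/
def kerForget (E F : ModuleCat.{0} ATilde) : Submodule ℂ (Abelian.Ext.{0} E F 1) :=
  LinearMap.ker (forgetA.mapExtLinearMap ℂ E F 1)

end

/-!
An extension of `F` by `E` and its reduction modulo `b ^ N` have the same image in
`Ext¹(F, E / b ^ N E)`: the push-out of the first along `E → E / b ^ N E` is the pull-back of the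
second along `F → F / b ^ N F` (`toTruncation_comp_extClass`). So the isomorphism is the composition
of the push-out map with the inverse of the pull-back map on the classes that vanish over `ℂ⟦b⟧`,
and it remains to see that both maps are bijective.

Both are computed from a free resolution `0 → Ã^k → Ã^k → F → 0` (`presentation_shortExact`). Its
first map is right multiplication by `a - M`, where `M` is the matrix of `a` in a `ℂ⟦b⟧`-basis of
`F`; exactness is division with remainder by `a - M` (`exists_eq_relations_add` and
`eq_zero_of_relations_add_eq_zero`). Hence every class in `Ext¹(F, Y)` comes from a morphism
`Ã^k → Y`.

* Pull-back is bijective for every `N`. A class that dies in `Ext¹(F, E / b ^ N E)` comes from a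
  morphism `b ^ N F → E / b ^ N E`; if it vanishes over `ℂ⟦b⟧`, then this morphism extends
  `ℂ⟦b⟧`-linearly to `F`, so it is zero. For surjectivity, a morphism `Ã^k → E / b ^ N E` factors
  through the reduction of `Ã^k`, and the reduced resolution of `F` is still exact.
* Push-out is surjective because `Ã^k` is projective. A class in its kernel is given by a morphism
  `Ã^k → b ^ N E`, that is, by a `ℂ⟦b⟧`-linear map `b ^ N φ : F → b ^ N E`. It is trivial if
  `b ^ N φ` is the commutator of `a` with some `ψ : F → E`, and for `E = E_λ` the inequality
  `N ≥ N(F^*, -λ)` provides such a `ψ` (`exists_commutator_eq`).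

The number `N(G, μ)` exists for every finitely generated `G` (`AAction.bounds_nonempty`). One
adjoins `v, a v, a ^ 2 v, ...` to a submodule on which the equation `a y = x` is solvable up to a
bounded power of `b`; this keeps the property, because integration by parts reduces the new
equations to one scalar formal differential equation, which is triangular with respect to the powers
of `b` with diagonal entries polynomial in the exponent.
-/

noncomputable section

open ATilde

/-! ### Formal differential operators on power series -/

/-- The operator `-b ^ 2 d/db` on `ℂ⟦b⟧`. -/
def negDelta (u : ℂ⟦X⟧) : ℂ⟦X⟧ := -(PowerSeries.X ^ 2 * PowerSeries.derivative ℂ u)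

theorem coeff_negDelta_zero (u : ℂ⟦X⟧) : PowerSeries.coeff 0 (negDelta u) = 0 := by
  simp [negDelta]

theorem coeff_negDelta_succ (u : ℂ⟦X⟧) (n : ℕ) :
    PowerSeries.coeff (n + 1) (negDelta u) = -(n * PowerSeries.coeff n u) := by
  cases n with
  | zero => simp [negDelta, pow_succ, mul_assoc, PowerSeries.coeff_succ_X_mul]
  | succ n =>
    rw [negDelta, map_neg, show n + 1 + 1 = n + 2 from rfl, PowerSeries.coeff_X_pow_mul]
    simp [PowerSeries.coeff_derivative]
    ring

theorem X_pow_dvd_negDelta {n : ℕ} {u : ℂ⟦X⟧} (h : PowerSeries.X ^ n ∣ u) :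
    PowerSeries.X ^ n ∣ negDelta u := by
  rw [PowerSeries.X_pow_dvd_iff] at h ⊢
  intro m hm
  cases m with
  | zero => exact coeff_negDelta_zero u
  | succ m => rw [coeff_negDelta_succ, h m (by omega)]; simp

theorem X_pow_dvd_negDelta_iterate {n : ℕ} {u : ℂ⟦X⟧} (h : PowerSeries.X ^ n ∣ u) (i : ℕ) :
    PowerSeries.X ^ n ∣ negDelta^[i] u := by
  induction i with
  | zero => exact h
  | succ i ih => rw [Function.iterate_succ_apply']; exact X_pow_dvd_negDelta ih

/-- The operator on `ℂ⟦b⟧` that sends `b ^ m` to `∑ k, χ k (m) * b ^ (m + k)`. -/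
def symbolOp (χ : ℕ → ℂ[X]) (u : ℂ⟦X⟧) : ℂ⟦X⟧ :=
  PowerSeries.mk fun N =>
    ∑ p ∈ Finset.HasAntidiagonal.antidiagonal N, PowerSeries.coeff p.1 u * (χ p.2).eval (p.1 : ℂ)

theorem coeff_symbolOp (χ : ℕ → ℂ[X]) (u : ℂ⟦X⟧) (N : ℕ) :
    PowerSeries.coeff N (symbolOp χ u) =
      ∑ p ∈ Finset.HasAntidiagonal.antidiagonal N,
        PowerSeries.coeff p.1 u * (χ p.2).eval (p.1 : ℂ) :=
  PowerSeries.coeff_mk _ _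

theorem symbolOp_sub (χ χ' : ℕ → ℂ[X]) (u : ℂ⟦X⟧) :
    symbolOp (χ - χ') u = symbolOp χ u - symbolOp χ' u := by
  ext N
  simp [coeff_symbolOp, mul_sub]

theorem symbolOp_sum {ι : Type*} (s : Finset ι) (χ : ι → ℕ → ℂ[X]) (u : ℂ⟦X⟧) :
    symbolOp (∑ i ∈ s, χ i) u = ∑ i ∈ s, symbolOp (χ i) u := by
  ext N
  simp only [coeff_symbolOp, map_sum, Finset.sum_apply, eval_finsetSum, Finset.mul_sum]
  rw [Finset.sum_comm]

/-- The symbol of multiplication by `c`. -/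
def constSymbol (c : ℂ⟦X⟧) : ℕ → ℂ[X] := fun k => C (PowerSeries.coeff k c)

theorem symbolOp_constSymbol (c u : ℂ⟦X⟧) : symbolOp (constSymbol c) u = c * u := by
  ext N
  rw [mul_comm c]
  simp [coeff_symbolOp, constSymbol, PowerSeries.coeff_mul]

/-- The symbol of the composition of `negDelta` with the operator of symbol `χ`. -/
def negDeltaSymbol (χ : ℕ → ℂ[X]) : ℕ → ℂ[X]
  | 0 => 0
  | k + 1 => -((X + C (k : ℂ)) * χ k)

theorem symbolOp_negDeltaSymbol (χ : ℕ → ℂ[X]) (u : ℂ⟦X⟧) :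
    symbolOp (negDeltaSymbol χ) u = negDelta (symbolOp χ u) := by
  ext N
  cases N with
  | zero => rw [coeff_negDelta_zero]; simp [coeff_symbolOp, negDeltaSymbol]
  | succ N =>
    rw [coeff_negDelta_succ, coeff_symbolOp, coeff_symbolOp, Finset.Nat.antidiagonal_succ']
    simp only [Finset.sum_cons, Finset.sum_map, negDeltaSymbol, eval_zero, mul_zero, zero_add,
      Finset.mul_sum, ← Finset.sum_neg_distrib]
    refine Finset.sum_congr rfl fun p hp => ?_
    rw [← Finset.HasAntidiagonal.mem_antidiagonal.mp hp]
    simp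
    ring

theorem symbolOp_negDeltaSymbol_iterate (χ : ℕ → ℂ[X]) (i : ℕ) (u : ℂ⟦X⟧) :
    symbolOp (negDeltaSymbol^[i] χ) u = negDelta^[i] (symbolOp χ u) := by
  induction i with
  | zero => rfl
  | succ i ih =>
    rw [Function.iterate_succ_apply', Function.iterate_succ_apply', symbolOp_negDeltaSymbol, ih]

theorem natDegree_negDeltaSymbol_iterate (c : ℂ⟦X⟧) (i k : ℕ) :
    (negDeltaSymbol^[i] (constSymbol c) k).natDegree ≤ i := by
  induction i generalizing k with
  | zero => simp [constSymbol]
  | succ i ih =>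
    rw [Function.iterate_succ_apply']
    cases k with
    | zero => simp [negDeltaSymbol]
    | succ k =>
      rw [negDeltaSymbol, natDegree_neg]
      refine natDegree_mul_le.trans ?_
      have := ih k
      rw [natDegree_X_add_C]
      omega

theorem coeff_negDeltaSymbol_iterate_one (i : ℕ) :
    (negDeltaSymbol^[i] (constSymbol 1) i).coeff i = (-1) ^ i := by
  induction i with
  | zero => simp [constSymbol]
  | succ i ih =>
    have h : (negDeltaSymbol^[i] (constSymbol 1) i).coeff (i + 1) = 0 :=
      coeff_eq_zero_of_natDegree_lt (Nat.lt_succ_of_le (natDegree_negDeltaSymbol_iterate 1 i i))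
    rw [Function.iterate_succ_apply', negDeltaSymbol, coeff_neg, add_mul, coeff_add,
      coeff_X_mul, coeff_C_mul, ih, h, pow_succ]
    ring

/-- An operator with nonzero symbol is triangular on the powers of `b`: if `c` is the least index
with `χ c ≠ 0`, its matrix has the entries `χ c (m)` on the `c`-th diagonal, and these vanish for
finitely many `m` only. -/
theorem exists_symbolOp_eq (χ : ℕ → ℂ[X]) (hχ : ∃ k, χ k ≠ 0) :
    ∃ c n₀ : ℕ, ∀ n ≥ n₀, ∀ f : ℂ⟦X⟧, PowerSeries.X ^ (n + c) ∣ f →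
      ∃ u : ℂ⟦X⟧, PowerSeries.X ^ n ∣ u ∧ symbolOp χ u = f := by
  classical
  set c := Nat.find hχ with hc
  have hc0 : χ c ≠ 0 := Nat.find_spec hχ
  have hlt : ∀ k < c, χ k = 0 := fun k hk => not_not.mp (Nat.find_min hχ hk)
  obtain ⟨n₀, hn₀⟩ : ∃ n₀ : ℕ, ∀ m ≥ n₀, (χ c).eval (m : ℂ) ≠ 0 := by
    have hfin : {m : ℕ | (χ c).eval (m : ℂ) = 0}.Finite := by
      refine ((χ c).roots.toFinset.finite_toSet.preimage
        (f := fun m : ℕ => (m : ℂ)) Nat.cast_injective.injOn).subset ?_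
      intro m hm
      simpa [hc0] using hm
    obtain ⟨B, hB⟩ := hfin.bddAbove
    exact ⟨B + 1, fun m hm h => by have := hB h; omega⟩
  refine ⟨c, n₀, fun n hn f hf => ?_⟩
  rw [PowerSeries.X_pow_dvd_iff] at hf
  -- the coefficients of `u`, by recursion along the diagonal
  let U : ℕ → ℂ := fun m => Nat.strongRec (motive := fun _ => ℂ) (fun m ih =>
    if m < n then 0 else
      (PowerSeries.coeff (m + c) f
        - ∑ j : Fin m, ih j j.2 * (χ (m + c - j)).eval ((j : ℕ) : ℂ)) / (χ c).eval (m : ℂ)) m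
  have hU : ∀ m, U m = if m < n then 0 else
      (PowerSeries.coeff (m + c) f
        - ∑ j ∈ Finset.range m, U j * (χ (m + c - j)).eval (j : ℂ)) / (χ c).eval (m : ℂ) := by
    intro m
    rw [← Fin.sum_univ_eq_sum_range (fun j => U j * (χ (m + c - j)).eval (j : ℂ))]
    simp only [U]
    conv_lhs => rw [Nat.strongRec]
  refine ⟨PowerSeries.mk U, ?_, ?_⟩
  · rw [PowerSeries.X_pow_dvd_iff]
    intro m hm
    rw [PowerSeries.coeff_mk, hU, if_pos hm]
  · ext N
    rw [coeff_symbolOp, Finset.Nat.sum_antidiagonal_eq_sum_range_succ_mk]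
    simp only [PowerSeries.coeff_mk]
    by_cases hN : N < c
    · rw [hf N (by omega)]
      refine Finset.sum_eq_zero fun j _ => ?_
      rw [hlt (N - j) (by omega)]
      simp
    · obtain ⟨m, rfl⟩ : ∃ m, N = m + c := ⟨N - c, by omega⟩
      have hsplit : ∑ j ∈ Finset.range (m + c).succ, U j * (χ (m + c - j)).eval (j : ℂ)
          = ∑ j ∈ Finset.range (m + 1), U j * (χ (m + c - j)).eval (j : ℂ) := by
        symm
        refine Finset.sum_subset (fun j => by simp; omega) fun j hj hj' => ?_
        simp only [Finset.mem_range] at hj hj'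
        rw [hlt (m + c - j) (by omega)]
        simp
      rw [hsplit, Finset.sum_range_succ, Nat.add_sub_cancel_left]
      by_cases hm : m < n
      · rw [hf _ (by omega), hU m, if_pos hm, zero_mul, add_zero]
        refine Finset.sum_eq_zero fun j hj => ?_
        simp only [Finset.mem_range] at hj
        rw [hU j, if_pos (by omega), zero_mul]
      · have hm' := hn₀ m (by omega)
        rw [hU m, if_neg hm, div_mul_cancel₀ _ hm']
        ring

/-- Solvability of a monic scalar formal differential equation, with a bounded loss of
divisibility by `b`. -/
theorem exists_adjoint_eq (r : ℕ) (c : ℕ → ℂ⟦X⟧) :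
    ∃ d n₀ : ℕ, ∀ n ≥ n₀, ∀ f : ℂ⟦X⟧, PowerSeries.X ^ (n + d) ∣ f →
      ∃ u : ℂ⟦X⟧, PowerSeries.X ^ n ∣ u ∧
        negDelta^[r] u - ∑ i ∈ Finset.range r, negDelta^[i] (c i * u) = f := by
  let χ : ℕ → ℂ[X] := negDeltaSymbol^[r] (constSymbol 1)
    - ∑ i ∈ Finset.range r, negDeltaSymbol^[i] (constSymbol (c i))
  -- only the leading term contributes to the coefficient of degree `r` of `χ r`
  have hχ : ∃ k, χ k ≠ 0 := by
    refine ⟨r, fun h => ?_⟩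
    have h1 := congrArg (fun p => p.coeff r) h
    simp only [χ, Pi.sub_apply, Finset.sum_apply, coeff_sub, finsetSum_coeff,
      coeff_negDeltaSymbol_iterate_one, coeff_zero] at h1
    rw [Finset.sum_eq_zero] at h1
    · simp at h1
    · intro i hi
      exact coeff_eq_zero_of_natDegree_lt
        ((natDegree_negDeltaSymbol_iterate _ i r).trans_lt (Finset.mem_range.mp hi))
  obtain ⟨d, n₀, h⟩ := exists_symbolOp_eq χ hχ
  refine ⟨d, n₀, fun n hn f hf => ?_⟩
  obtain ⟨u, hu, hu'⟩ := h n hn f hf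
  refine ⟨u, hu, ?_⟩
  rw [← hu']
  simp only [χ, symbolOp_sub, symbolOp_sum, symbolOp_negDeltaSymbol_iterate, symbolOp_constSymbol,
    one_mul]

/-! ### The image of `a` contains a power of `b` -/

namespace AAction

variable {G : Type} [AddCommGroup G] [Module ℂ⟦X⟧ G]

/-- The action of `a - μ b`, which obeys the same rule as `a`. -/
def shift (s : AAction G) (μ : ℂ) : AAction G where
  a :=
    { toFun := fun x => s.a x - (PowerSeries.C μ * PowerSeries.X : ℂ⟦X⟧) • x
      map_zero' := by simp
      map_add' := fun x y => by rw [map_add, smul_add]; abel }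
  a_smul S x := by
    change s.a (S • x) - _ = S • (s.a x - _) + _
    rw [s.a_smul, smul_sub, smul_smul, smul_smul, mul_comm S]
    abel

theorem shift_a (s : AAction G) (μ : ℂ) (x : G) :
    (s.shift μ).a x = s.a x - (PowerSeries.C μ * PowerSeries.X : ℂ⟦X⟧) • x := rfl

/-- The equation `a y = x` is solvable inside `H`, with a bounded loss of divisibility by `b`. -/
def SolvableOn (s : AAction G) (H : Submodule ℂ⟦X⟧ G) : Prop :=
  ∃ c n₀ : ℕ, ∀ n ≥ n₀, ∀ x ∈ H, ∃ y ∈ H,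
    (PowerSeries.X ^ (n + c) : ℂ⟦X⟧) • x = s.a ((PowerSeries.X ^ n : ℂ⟦X⟧) • y)

/-- The additive subgroup `a (b ^ n * H)`. -/
def imagePow (s : AAction G) (H : Submodule ℂ⟦X⟧ G) (n : ℕ) : AddSubgroup G :=
  H.toAddSubgroup.map (s.a.comp (DistribSMul.toAddMonoidHom G (PowerSeries.X ^ n : ℂ⟦X⟧)))

/-- Integration by parts: modulo the image of `a`, the action of `a` on a multiple of `w` becomes
`-b ^ 2 d/db` on the coefficient. -/
theorem smul_iterate_sub_mem (s : AAction G) (H : Submodule ℂ⟦X⟧ G) (v : G) (n i : ℕ)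
    (hv : ∀ j < i, s.a^[j] v ∈ H) (S : ℂ⟦X⟧) (hS : PowerSeries.X ^ n ∣ S) :
    S • s.a^[i] v - (negDelta^[i] S) • v ∈ s.imagePow H n := by
  induction i generalizing S with
  | zero => simp
  | succ i ih =>
    have h1 := ih (fun j hj => hv j (by omega)) (negDelta S) (X_pow_dvd_negDelta hS)
    obtain ⟨T, rfl⟩ := hS
    have h2 : s.a ((PowerSeries.X ^ n * T : ℂ⟦X⟧) • s.a^[i] v) ∈ s.imagePow H n :=
      ⟨T • s.a^[i] v, H.smul_mem _ (hv i (by omega)), by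
        change s.a ((PowerSeries.X ^ n : ℂ⟦X⟧) • T • s.a^[i] v) = _
        rw [smul_smul]⟩
    have h3 := (s.imagePow H n).add_mem h1 h2
    rw [s.a_smul] at h3
    rw [Function.iterate_succ_apply', Function.iterate_succ_apply]
    convert h3 using 1
    simp only [negDelta, neg_smul]
    abel

/-- `H + ℂ⟦b⟧ v + ℂ⟦b⟧ a v + ... + ℂ⟦b⟧ a ^ (r - 1) v`. -/
def adjoinIterates (s : AAction G) (H : Submodule ℂ⟦X⟧ G) (v : G) (r : ℕ) : Submodule ℂ⟦X⟧ G :=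
  H ⊔ Submodule.span ℂ⟦X⟧ ((fun i => s.a^[i] v) '' (Finset.range r : Set ℕ))

theorem mem_adjoinIterates (s : AAction G) (H : Submodule ℂ⟦X⟧ G) (v : G) (r : ℕ) (x : G) :
    x ∈ s.adjoinIterates H v r ↔
      ∃ h ∈ H, ∃ c : ℕ → ℂ⟦X⟧, h + ∑ i ∈ Finset.range r, c i • s.a^[i] v = x := by
  rw [adjoinIterates, Submodule.mem_sup]
  constructor
  · rintro ⟨h, hh, z, hz, rfl⟩
    rw [Submodule.mem_span_image_finset_iff_exists_fun'] at hz
    obtain ⟨c, rfl⟩ := hz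
    exact ⟨h, hh, c, rfl⟩
  · rintro ⟨h, hh, c, rfl⟩
    exact ⟨h, hh, _, Submodule.sum_mem _ fun i hi => Submodule.smul_mem _ _
      (Submodule.subset_span ⟨i, hi, rfl⟩), rfl⟩

theorem iterate_mem_adjoinIterates (s : AAction G) (H : Submodule ℂ⟦X⟧ G) (v : G) {r i : ℕ}
    (hi : i < r) : s.a^[i] v ∈ s.adjoinIterates H v r :=
  Submodule.mem_sup_right (Submodule.subset_span ⟨i, by simpa using hi, rfl⟩)

/-- Passing from `H` to `H + ℂ⟦b⟧[a] v`: modulo `H` and the image of `a`, the equation becomes the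
scalar equation for the adjoint of the operator that annihilates `v` modulo `H`. -/
theorem SolvableOn.adjoinIterates {s : AAction G} {H : Submodule ℂ⟦X⟧ G} (hH : s.SolvableOn H)
    {v : G} {r : ℕ} (hv : s.a^[r] v ∈ s.adjoinIterates H v r) :
    s.SolvableOn (s.adjoinIterates H v r) := by
  obtain ⟨h, hh, c, hc⟩ := (s.mem_adjoinIterates H v r _).mp hv
  obtain ⟨d, m₀, hd⟩ := exists_adjoint_eq r c
  obtain ⟨e, n₀, he⟩ := hH
  have hle : H ≤ s.adjoinIterates H v r := le_sup_left
  refine ⟨e + d, max m₀ n₀, fun n hn x hx => ?_⟩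
  set W := s.imagePow (s.adjoinIterates H v r) n with hW
  suffices (PowerSeries.X ^ (n + (e + d)) : ℂ⟦X⟧) • x ∈ W by
    obtain ⟨y, hy, hy'⟩ := this
    exact ⟨y, hy, hy'.symm⟩
  have hHW : ∀ z ∈ H, ∀ T : ℂ⟦X⟧, PowerSeries.X ^ (n + e) ∣ T → T • z ∈ W := by
    rintro z hz _ ⟨T, rfl⟩
    obtain ⟨y, hy, hy'⟩ := he n (le_trans (le_max_right _ _) hn) (T • z) (H.smul_mem _ hz)
    exact ⟨y, hle hy, by rw [mul_smul, hy']; rfl⟩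
  have hparts : ∀ i ≤ r, ∀ T : ℂ⟦X⟧, PowerSeries.X ^ n ∣ T →
      T • s.a^[i] v - (negDelta^[i] T) • v ∈ W := fun i hi T hT =>
    s.smul_iterate_sub_mem _ v n i
      (fun j hj => s.iterate_mem_adjoinIterates H v (lt_of_lt_of_le hj hi)) T hT
  -- multiples of `v` itself
  have hvW : ∀ T : ℂ⟦X⟧, PowerSeries.X ^ (n + (e + d)) ∣ T → T • v ∈ W := by
    intro T hT
    obtain ⟨u, hu, rfl⟩ := hd (n + e) (by have := le_max_left m₀ n₀; omega) T
      (by rwa [add_assoc])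
    have hun : PowerSeries.X ^ n ∣ u := (pow_dvd_pow _ (Nat.le_add_right _ _)).trans hu
    have h1 := hparts r le_rfl u hun
    have h2 : ∑ i ∈ Finset.range r,
        ((c i * u) • s.a^[i] v - (negDelta^[i] (c i * u)) • v) ∈ W :=
      AddSubgroup.sum_mem _ fun i hi =>
        hparts i (Finset.mem_range.mp hi).le _ (hun.mul_left _)
    have h3 := hHW h hh u hu
    have h4 := W.sub_mem (W.add_mem h3 h2) h1
    convert h4 using 1
    rw [← hc, sub_smul, Finset.sum_smul, smul_add, Finset.smul_sum, Finset.sum_sub_distrib]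
    simp only [smul_smul, mul_comm u]
    abel
  obtain ⟨h', hh', x', rfl⟩ := (s.mem_adjoinIterates H v r _).mp hx
  rw [smul_add, Finset.smul_sum]
  refine W.add_mem (hHW _ hh' _ (pow_dvd_pow _ (by omega))) (AddSubgroup.sum_mem _ fun i hi => ?_)
  rw [smul_smul]
  have hdvd : (PowerSeries.X ^ (n + (e + d)) : ℂ⟦X⟧) ∣ PowerSeries.X ^ (n + (e + d)) * x' i :=
    dvd_mul_right _ _
  have h1 := hparts i (Finset.mem_range.mp hi).le _
    ((pow_dvd_pow _ (Nat.le_add_right _ _)).trans hdvd)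
  have h2 := hvW _ (X_pow_dvd_negDelta_iterate hdvd i)
  simpa using W.add_mem h1 h2

/-- A maximal submodule on which the equation is solvable is everything: for any `v`, the iterates
`a ^ i v` generate a submodule that is finitely generated, so `adjoinIterates` applies. -/
theorem solvableOn_top (s : AAction G) [IsNoetherian ℂ⟦X⟧ G] : s.SolvableOn ⊤ := by
  obtain ⟨H, hH, hmax⟩ := WellFounded.has_min
    (wellFounded_gt (α := Submodule ℂ⟦X⟧ G)) {H | s.SolvableOn H}
    ⟨⊥, 0, 0, fun n _ x hx => ⟨0, zero_mem _, by simp [(Submodule.mem_bot _).mp hx]⟩⟩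
  by_cases hT : H = ⊤
  · exact hT ▸ hH
  exfalso
  obtain ⟨v, -, hv⟩ := SetLike.exists_of_lt (lt_top_iff_ne_top.mpr hT)
  let chain : ℕ →o Submodule ℂ⟦X⟧ G :=
    ⟨fun r => s.adjoinIterates H v (r + 1), fun i j hij => sup_le_sup_left
      (Submodule.span_mono (Set.image_mono (by
        intro k; simp; omega))) _⟩
  obtain ⟨r, hr⟩ := monotone_stabilizes_iff_noetherian.mpr inferInstance chain
  have hr' : s.adjoinIterates H v (r + 1) = s.adjoinIterates H v (r + 1 + 1) :=
    hr (r + 1) (by omega)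
  refine hmax (s.adjoinIterates H v (r + 1)) (hH.adjoinIterates ?_) ?_
  · rw [hr']
    exact s.iterate_mem_adjoinIterates H v (by omega)
  · exact lt_of_le_of_ne le_sup_left fun h => hv (by
      rw [h]; exact s.iterate_mem_adjoinIterates H v (i := 0) (by omega))

theorem bounds_nonempty (s : AAction G) [IsNoetherian ℂ⟦X⟧ G] (μ : ℂ) : (s.bounds μ).Nonempty := by
  obtain ⟨c, n₀, h⟩ := (s.shift μ).solvableOn_top
  refine ⟨n₀ + c, fun N hN x => ?_⟩
  obtain ⟨y, -, hy⟩ := h (N - c) (by omega) x trivial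
  rw [Nat.sub_add_cancel (by omega)] at hy
  exact ⟨_, hy.trans (s.shift_a μ _)⟩

theorem exists_eq_of_leastBound_le (s : AAction G) [IsNoetherian ℂ⟦X⟧ G] {μ : ℂ} {N : ℕ}
    (hN : s.leastBound μ ≤ N) (x : G) : ∃ y : G,
    (PowerSeries.X ^ N : ℂ⟦X⟧) • x = s.a y - (PowerSeries.C μ * PowerSeries.X : ℂ⟦X⟧) • y :=
  Nat.sInf_mem (s.bounds_nonempty μ) N hN x

end AAction

/-! ### Division with remainder in free modules over the algebra -/

section PolynomialDivision

variable {ι : Type} [Fintype ι]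

/-- The map `p ↦ p (X - M)` on row vectors of polynomials, for a constant matrix `M`. -/
def mulXSub (M : ι → ι → ℂ) (p : ι → ℂ[X]) : ι → ℂ[X] :=
  fun j => p j * X - ∑ i, p i * C (M i j)

theorem mulXSub_add (M : ι → ι → ℂ) (p q : ι → ℂ[X]) :
    mulXSub M (p + q) = mulXSub M p + mulXSub M q := by
  ext1 j
  simp only [mulXSub, Pi.add_apply, add_mul, Finset.sum_add_distrib]
  ring

/-- Division by `X - M` with constant remainder. -/
theorem exists_eq_mulXSub_add (M : ι → ι → ℂ) (p : ι → ℂ[X]) :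
    ∃ (q : ι → ℂ[X]) (r : ι → ℂ), p = mulXSub M q + fun j => C (r j) := by
  obtain ⟨d, hd⟩ : ∃ d, ∀ j, (p j).natDegree ≤ d :=
    ⟨Finset.univ.sup fun j => (p j).natDegree, fun j => Finset.le_sup (f := fun j =>
      (p j).natDegree) (Finset.mem_univ j)⟩
  induction d generalizing p with
  | zero =>
    refine ⟨0, fun j => (p j).coeff 0, ?_⟩
    ext1 j
    simpa [mulXSub] using eq_C_of_natDegree_le_zero (hd j)
  | succ d ih =>
    obtain ⟨q, r, hqr⟩ := ih (fun j => (p j).divX) fun j => by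
      rw [natDegree_divX_eq_natDegree_tsub_one]
      have := hd j
      omega
    refine ⟨(fun j => q j * X) + fun j => C (r j),
      fun j => ∑ i, r i * M i j + (p j).coeff 0, ?_⟩
    rw [mulXSub_add]
    ext1 j
    have h := congrFun hqr j
    simp only [mulXSub, Pi.add_apply] at h ⊢
    have h2 : ∑ i, q i * X * C (M i j) = (∑ i, q i * C (M i j)) * X := by
      rw [Finset.sum_mul]
      exact Finset.sum_congr rfl fun i _ => by ring
    conv_lhs => rw [← divX_mul_X_add (p j), h]
    rw [h2]
    simp only [map_add, map_sum, map_mul]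
    ring

theorem eq_zero_of_mulXSub_add_eq_zero (M : ι → ι → ℂ) (q : ι → ℂ[X]) (r : ι → ℂ)
    (h : (mulXSub M q + fun j => C (r j)) = 0) : q = 0 := by
  have hc : ∀ k j, (q j).coeff k = ∑ i, (q i).coeff (k + 1) * M i j := by
    intro k j
    have h1 := congrArg (fun p => p.coeff (k + 1)) (congrFun h j)
    simp only [mulXSub, Pi.add_apply, coeff_add, coeff_sub, coeff_mul_X, finsetSum_coeff,
      coeff_mul_C, coeff_C_succ, Pi.zero_apply, coeff_zero, add_zero] at h1
    exact sub_eq_zero.mp h1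
  set K := Finset.univ.sup (fun j => (q j).natDegree) + 1 with hK
  -- descending induction on the degree, starting above all degrees
  have hd : ∀ d m, K ≤ m + d → ∀ j, (q j).coeff m = 0 := by
    intro d
    induction d with
    | zero =>
      intro m hm j
      apply coeff_eq_zero_of_natDegree_lt
      have : (q j).natDegree ≤ _ :=
        Finset.le_sup (f := fun j => (q j).natDegree) (Finset.mem_univ j)
      omega
    | succ d ih =>
      intro m hm j
      rw [hc]
      exact Finset.sum_eq_zero fun i _ => by rw [ih (m + 1) (by omega), zero_mul]
  ext j m
  exact hd K m (by omega) j

end PolynomialDivision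

namespace ATilde

theorem bMul_iter_coeff_self (n : ℕ) (y : ATilde) : (bMul^[n] y) n = y 0 := by
  induction n with
  | zero => rfl
  | succ n ih =>
    have h := bMul_iter_coeff_of_lt (n + 1) y n (Nat.lt_succ_self n)
    rw [Function.iterate_succ_apply'] at h ⊢
    rw [bMul_coeff_succ, ih, h]
    simp

theorem mul_coeff_of_coeff_eq_zero {x : ATilde} {n : ℕ} (hx : ∀ m < n, x m = 0) (y : ATilde) :
    (x * y) n = x n * y 0 := by
  rw [mul_coeff, Finset.sum_range_succ, bMul_iter_coeff_self, Finset.sum_eq_zero, zero_add]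
  intro i hi
  rw [hx i (Finset.mem_range.mp hi), zero_mul]

theorem ofPowerSeries_injective : Function.Injective ofPowerSeries := by
  intro S T h
  ext n
  exact C_injective (congrArg (fun x : ATilde => x n) h)

theorem ofPowerSeries_X : ofPowerSeries PowerSeries.X = b := by
  ext1 n
  rw [ofPowerSeries_coeff, PowerSeries.coeff_X]
  by_cases h : n = 1 <;> simp [b, single, h]

theorem ofPowerSeries_X_pow (N : ℕ) : ofPowerSeries (PowerSeries.X ^ N) = b ^ N := by
  rw [map_pow, ofPowerSeries_X]

theorem sum_coeff {ι : Type} (s : Finset ι) (x : ι → ATilde) (n : ℕ) :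
    (∑ i ∈ s, x i) n = ∑ i ∈ s, x i n :=
  Finset.sum_apply n s x

section Relations

variable {ι : Type} [Fintype ι]

/-- Right multiplication by `a - M` on row vectors, for a matrix `M` over `ℂ⟦b⟧`; its image is the
module of relations `a e_i = ∑ j, M i j e_j`. -/
def relations (M : ι → ι → ℂ⟦X⟧) : (ι → ATilde) →ₗ[ATilde] (ι → ATilde) where
  toFun q j := q j * a - ∑ i, q i * ofPowerSeries (M i j)
  map_add' p q := by
    ext1 j
    simp only [Pi.add_apply, add_mul, Finset.sum_add_distrib]
    abel
  map_smul' c q := by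
    ext1 j
    simp only [Pi.smul_apply, smul_eq_mul, RingHom.id_apply, mul_sub, Finset.mul_sum, mul_assoc]

theorem relations_apply (M : ι → ι → ℂ⟦X⟧) (q : ι → ATilde) (j : ι) :
    relations M q j = q j * a - ∑ i, q i * ofPowerSeries (M i j) := rfl

/-- Modulo `b`, right multiplication by `a - M` is `mulXSub`. -/
theorem relations_coeff_of_coeff_eq_zero (M : ι → ι → ℂ⟦X⟧) {q : ι → ATilde} {n : ℕ}
    (hq : ∀ j, ∀ m < n, q j m = 0) (j : ι) :
    relations M q j n
      = mulXSub (fun i j => PowerSeries.coeff 0 (M i j)) (fun i => q i n) j := by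
  rw [relations_apply, sub_coeff, sum_coeff, mul_coeff_of_coeff_eq_zero (hq j), mulXSub]
  congr 1
  exact Finset.sum_congr rfl fun i _ => mul_coeff_of_coeff_eq_zero (hq i) _

/-- Uniqueness in the division by `a - M` with remainder in `ℂ⟦b⟧`. -/
theorem eq_zero_of_relations_add_eq_zero (M : ι → ι → ℂ⟦X⟧) (q : ι → ATilde) (r : ι → ℂ⟦X⟧)
    (h : (relations M q + fun j => ofPowerSeries (r j)) = 0) : q = 0 := by
  have hq : ∀ n j, q j n = 0 := by
    intro n
    induction n using Nat.strong_induction_on with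
    | _ n ih =>
      refine fun j => congrFun (eq_zero_of_mulXSub_add_eq_zero
        (fun i j => PowerSeries.coeff 0 (M i j)) (fun j => q j n)
        (fun j => PowerSeries.coeff n (r j)) ?_) j
      ext1 j
      rw [Pi.add_apply, ← relations_coeff_of_coeff_eq_zero M fun j m hm => ih m hm j]
      exact congrArg (fun x : ATilde => x n) (congrFun h j)
  ext j n
  rw [hq]
  rfl

theorem relations_injective (M : ι → ι → ℂ⟦X⟧) : Function.Injective (relations M) := by
  rw [injective_iff_map_eq_zero]
  refine fun q hq => eq_zero_of_relations_add_eq_zero M q 0 ?_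
  ext1 j
  simp [hq]

/-- Division by `a - M` with remainder in `ℂ⟦b⟧`, carried out one power of `b` at a time. -/
theorem exists_eq_relations_add (M : ι → ι → ℂ⟦X⟧) (x : ι → ATilde) :
    ∃ (q : ι → ATilde) (r : ι → ℂ⟦X⟧), x = relations M q + fun j => ofPowerSeries (r j) := by
  choose dq dr hdiv using exists_eq_mulXSub_add (fun i j => PowerSeries.coeff 0 (M i j))
  let Q : ℕ → ι → ℂ[X] := fun n => Nat.strongRec (motive := fun _ => ι → ℂ[X]) (fun n ih =>
    dq fun j => x j n
      - relations M (fun i m => if h : m < n then ih m h i else 0 : ι → ATilde) j n) n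
  let trunc : ℕ → ι → ATilde := fun n i m => if m < n then Q m i else 0
  have hQ : ∀ n, Q n = dq fun j => x j n - relations M (trunc n) j n := by
    intro n
    simp only [Q]
    rw [Nat.strongRec]
    rfl
  refine ⟨fun i n => Q n i,
    fun j => PowerSeries.mk fun n => dr (fun j => x j n - relations M (trunc n) j n) j, ?_⟩
  ext1 j
  ext1 n
  let high : ι → ATilde := fun i m => if m < n then 0 else Q m i
  have hsplit : (fun i n => Q n i : ι → ATilde) = trunc n + high := by
    ext1 i
    ext1 m
    change Q m i = (if m < n then Q m i else 0) + (if m < n then 0 else Q m i)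
    split_ifs <;> simp
  have hhigh : relations M high j n
      = mulXSub (fun i j => PowerSeries.coeff 0 (M i j)) (Q n) j := by
    rw [relations_coeff_of_coeff_eq_zero M (fun i m hm => if_pos hm)]
    simp
  have h := congrFun (hdiv fun j => x j n - relations M (trunc n) j n) j
  rw [← hQ] at h
  rw [Pi.add_apply, add_coeff, ofPowerSeries_coeff, PowerSeries.coeff_mk, hsplit, map_add,
    Pi.add_apply, add_coeff, hhigh, add_assoc]
  exact eq_add_of_sub_eq' h

end Relations

end ATilde

/-! ### The modules `E_λ` -/

/-- The map `S(b) ↦ [S(b)]` from `ℂ⟦b⟧` to `E_λ`. -/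
def toELam (lam : ℂ) : ℂ⟦X⟧ →ₗ[ℂ⟦X⟧] forgetA.obj (ELam lam) where
  toFun S := (Submodule.Quotient.mk (ofPowerSeries S) :
    ATilde ⧸ (Submodule.span ATilde {a - lam • b} : Submodule ATilde ATilde))
  map_add' S T := by rw [map_add]; rfl
  map_smul' S T := by rw [smul_eq_mul, map_mul]; rfl

theorem toELam_apply (lam : ℂ) (S : ℂ⟦X⟧) :
    toELam lam S = (Submodule.Quotient.mk (ofPowerSeries S) :
      ATilde ⧸ (Submodule.span ATilde {a - lam • b} : Submodule ATilde ATilde)) := rfl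

theorem ofPowerSeries_C_mul_X (lam : ℂ) :
    ofPowerSeries (PowerSeries.C lam * PowerSeries.X) = lam • b := by
  rw [← ofPowerSeries_X, ← map_smul, PowerSeries.smul_eq_C_mul]

theorem relations_unit (lam : ℂ) (q : Unit → ATilde) (j : Unit) :
    relations (fun _ _ => PowerSeries.C lam * PowerSeries.X) q j
      = q () * (a - lam • b) := by
  simp [relations_apply, ofPowerSeries_C_mul_X, mul_sub]

theorem toELam_bijective (lam : ℂ) : Function.Bijective (toELam lam) := by
  constructor
  · rw [injective_iff_map_eq_zero]
    intro S hS
    rw [toELam_apply] at hS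
    obtain ⟨q, hq⟩ := Submodule.mem_span_singleton.mp ((Submodule.Quotient.mk_eq_zero _).mp hS)
    have h := eq_zero_of_relations_add_eq_zero
      (fun _ _ : Unit => PowerSeries.C lam * PowerSeries.X) (fun _ => -q) (fun _ => S) (by
        ext1 j
        rw [Pi.add_apply, relations_unit, neg_mul, ← smul_eq_mul, hq]
        simp)
    have hq0 : q = 0 := neg_eq_zero.mp (congrFun h ())
    apply ofPowerSeries_injective
    rw [← hq, hq0, zero_smul, map_zero]
  · intro y
    obtain ⟨x, rfl⟩ := Submodule.Quotient.mk_surjective _ y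
    obtain ⟨q, r, h⟩ := exists_eq_relations_add
      (fun _ _ : Unit => PowerSeries.C lam * PowerSeries.X) (fun _ => x)
    refine ⟨r (), ?_⟩
    rw [toELam_apply]
    refine ((Submodule.Quotient.eq _).mpr ?_).symm
    have h1 : x = _ := congrFun h ()
    rw [Pi.add_apply, relations_unit] at h1
    exact Submodule.mem_span_singleton.mpr ⟨q (), by rw [h1, add_sub_cancel_right]; rfl⟩

/-- `E_λ` is free of rank one over `ℂ⟦b⟧`, with generator the class of `1`. -/
def equivELam (lam : ℂ) : ℂ⟦X⟧ ≃ₗ[ℂ⟦X⟧] forgetA.obj (ELam lam) :=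
  LinearEquiv.ofBijective (toELam lam) (toELam_bijective lam)

theorem a_smul_equivELam (lam : ℂ) (S : ℂ⟦X⟧) :
    (AAction.ofModule (ELam lam)).a (equivELam lam S) =
      equivELam lam (PowerSeries.C lam * PowerSeries.X * S
        + PowerSeries.X ^ 2 * PowerSeries.derivative ℂ S) := by
  change (Submodule.Quotient.mk (a * ofPowerSeries S) :
    ATilde ⧸ (Submodule.span ATilde {a - lam • b} : Submodule ATilde ATilde))
    = Submodule.Quotient.mk (ofPowerSeries _)
  rw [Submodule.Quotient.eq, a_mul_ofPowerSeries, map_add, add_sub_add_right_eq_sub, mul_comm _ S,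
    map_mul, ofPowerSeries_C_mul_X, ← mul_sub]
  exact Submodule.mem_span_singleton.mpr ⟨_, rfl⟩

theorem isABModule_ELam (lam : ℂ) : IsABModule (ELam lam) where
  free := Module.Free.of_equiv (equivELam lam)
  finite := Module.Finite.equiv (equivELam lam)

/-- The `ℂ⟦b⟧`-linear identification of `E_0` with `E_λ`. -/
def equivELamZero (lam : ℂ) : forgetA.obj (ELam 0) ≃ₗ[ℂ⟦X⟧] forgetA.obj (ELam lam) :=
  (equivELam 0).symm.trans (equivELam lam)

theorem a_equivELamZero (lam : ℂ) (x : forgetA.obj (ELam 0)) :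
    (AAction.ofModule (ELam lam)).a (equivELamZero lam x)
      = equivELamZero lam ((AAction.ofModule (ELam 0)).a x)
        + (PowerSeries.C lam * PowerSeries.X : ℂ⟦X⟧) • equivELamZero lam x := by
  obtain ⟨S, rfl⟩ := (equivELam 0).surjective x
  simp only [equivELamZero, a_smul_equivELam, LinearEquiv.trans_apply,
    LinearEquiv.symm_apply_apply, ← map_smul, ← map_add, smul_eq_mul]
  congr 1
  simp [add_comm]

/-! ### The dual module -/

theorem evalNegHom_evalNegHom (S : ℂ⟦X⟧) :
    PowerSeries.evalNegHom (PowerSeries.evalNegHom S) = S := by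
  ext n
  simp [PowerSeries.evalNegHom, PowerSeries.coeff_rescale, ← mul_assoc, ← mul_pow]

theorem isNoetherian_dual (F : ModuleCat.{0} ATilde) (hF : IsABModule F) :
    IsNoetherian ℂ⟦X⟧ (Dual F) := by
  have := hF.free
  have := hF.finite
  have := (isABModule_ELam 0).free
  have := (isABModule_ELam 0).finite
  have : RingHomSurjective (PowerSeries.evalNegHom : ℂ⟦X⟧ →+* ℂ⟦X⟧) :=
    ⟨fun S => ⟨_, evalNegHom_evalNegHom S⟩⟩
  -- the identity is semilinear from the untwisted to the twisted structure
  let f : (forgetA.obj F →ₗ[ℂ⟦X⟧] forgetA.obj (ELam 0))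
      →ₛₗ[(PowerSeries.evalNegHom : ℂ⟦X⟧ →+* ℂ⟦X⟧)] Dual F :=
    { toFun := fun φ => φ
      map_add' := fun _ _ => rfl
      map_smul' := fun S φ => by
        refine LinearMap.ext fun x => ?_
        change S • φ x = PowerSeries.evalNegHom (PowerSeries.evalNegHom S) • φ x
        rw [evalNegHom_evalNegHom] }
  have : Module.Finite ℂ⟦X⟧ (Dual F) := Module.Finite.of_surjective f fun φ => ⟨φ, rfl⟩
  infer_instance

/-- For `N` at least `N(F^*, -λ)`, every element of `b ^ N * Hom(F, E_λ)` is a commutator with `a`: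
the identification of `E_0` with `E_λ` turns the action of `a + λ b` on `F^*` into the action of `a`
on `Hom(F, E_λ)`. -/
theorem exists_commutator_eq (F : ModuleCat.{0} ATilde) (hF : IsABModule F) (lam : ℂ) {N : ℕ}
    (hN : (dualAction F).leastBound (-lam) ≤ N)
    (φ : forgetA.obj F →ₗ[ℂ⟦X⟧] forgetA.obj (ELam lam)) :
    ∃ ψ : forgetA.obj F →ₗ[ℂ⟦X⟧] forgetA.obj (ELam lam), ∀ x,
      (AAction.ofModule (ELam lam)).a (ψ x) - ψ ((AAction.ofModule F).a x)
        = (PowerSeries.X ^ N : ℂ⟦X⟧) • φ x := by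
  have := isNoetherian_dual F hF
  let θ := equivELamZero lam
  -- the signs come from `b` acting on the dual as `-b`
  let φ₀ : forgetA.obj F →ₗ[ℂ⟦X⟧] forgetA.obj (ELam 0) := ((-1 : ℂ⟦X⟧) ^ (N + 1)) • (θ.symm ∘ₗ φ)
  obtain ⟨ψ₀, hψ₀⟩ := (dualAction F).exists_eq_of_leastBound_le hN (show Dual F from φ₀)
  let ψ₁ : forgetA.obj F →ₗ[ℂ⟦X⟧] forgetA.obj (ELam 0) := ψ₀
  refine ⟨θ ∘ₗ ψ₁, fun x => ?_⟩
  have h : PowerSeries.evalNegHom (PowerSeries.X ^ N : ℂ⟦X⟧) • φ₀ x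
      = (ψ₁ ((AAction.ofModule F).a x) - (AAction.ofModule (ELam 0)).a (ψ₁ x))
        - PowerSeries.evalNegHom (PowerSeries.C (-lam) * PowerSeries.X : ℂ⟦X⟧) • ψ₁ x :=
    congrArg (fun χ : Dual F => χ x) hψ₀
  have hC : PowerSeries.evalNegHom (PowerSeries.C (-lam) : ℂ⟦X⟧) = PowerSeries.C (-lam) := by
    ext n
    rw [PowerSeries.evalNegHom, PowerSeries.coeff_rescale, PowerSeries.coeff_C]
    split_ifs with h <;> simp [h]
  rw [map_mul, map_pow, PowerSeries.evalNegHom_X, hC] at h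
  have h1 := congrArg θ h
  simp only [φ₀, LinearMap.smul_apply, map_sub, map_smul, smul_smul, LinearMap.comp_apply,
    LinearEquiv.coe_coe, LinearEquiv.apply_symm_apply] at h1
  have h2 : (-PowerSeries.X : ℂ⟦X⟧) ^ N * (-1) ^ (N + 1) = - PowerSeries.X ^ N := by
    rw [neg_pow, pow_succ]
    have : ((-1 : ℂ⟦X⟧) ^ N) * (-1) ^ N = 1 := by rw [← mul_pow]; simp
    linear_combination (-PowerSeries.X ^ N : ℂ⟦X⟧) * this
  have h3 : (PowerSeries.C (-lam) * -PowerSeries.X : ℂ⟦X⟧) = PowerSeries.C lam * PowerSeries.X := by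
    rw [map_neg, neg_mul_neg]
  rw [h2, h3, neg_smul] at h1
  have h4 : (AAction.ofModule (ELam lam)).a (θ (ψ₁ x))
      = θ ((AAction.ofModule (ELam 0)).a (ψ₁ x))
        + (PowerSeries.C lam * PowerSeries.X : ℂ⟦X⟧) • θ (ψ₁ x) := a_equivELamZero lam (ψ₁ x)
  change (AAction.ofModule (ELam lam)).a (θ (ψ₁ x)) - θ (ψ₁ ((AAction.ofModule F).a x)) = _
  rw [h4, ← neg_inj, h1]
  abel

/-! ### A free resolution of length one -/

section Presentation

variable {ι : Type} [Fintype ι]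

/-- The map from row vectors over the algebra that sends the `i`-th unit vector to `z i`. -/
def rowMap {G : ModuleCat.{0} ATilde} (z : ι → G) :
    ModuleCat.of ATilde (ι → ATilde) ⟶ G :=
  ModuleCat.ofHom
    { toFun := fun q => ∑ i, q i • z i
      map_add' := fun p q => by simp [add_smul, Finset.sum_add_distrib]
      map_smul' := fun c q => by simp [mul_smul, Finset.smul_sum] }

theorem rowMap_apply {G : ModuleCat.{0} ATilde} (z : ι → G) (q : ι → ATilde) :
    (rowMap z).hom q = ∑ i, q i • z i := rfl

theorem rowMap_single [DecidableEq ι] {G : ModuleCat.{0} ATilde} (z : ι → G) (i : ι) :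
    (rowMap z).hom (Pi.single i 1) = z i := by
  rw [rowMap_apply, Finset.sum_eq_single i]
  · rw [Pi.single_eq_same, one_smul]
  · intro j _ hj
    rw [Pi.single_eq_of_ne hj, zero_smul]
  · simp

theorem eq_rowMap [DecidableEq ι] {G : ModuleCat.{0} ATilde}
    (g : ModuleCat.of ATilde (ι → ATilde) ⟶ G) :
    g = rowMap fun i => g.hom (Pi.single i 1) := by
  refine ModuleCat.hom_ext (LinearMap.pi_ext fun i x => ?_)
  have hx : (Pi.single i x : ι → ATilde) = x • Pi.single i 1 := by
    rw [← Pi.single_smul, smul_eq_mul, mul_one]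
  rw [hx, map_smul, map_smul, rowMap_single]

theorem relations_comp_rowMap {G : ModuleCat.{0} ATilde} (M : ι → ι → ℂ⟦X⟧) (z : ι → G) :
    ModuleCat.ofHom (relations M) ≫ rowMap z
      = rowMap fun i => a • z i - ∑ j, ofPowerSeries (M i j) • z j := by
  refine ModuleCat.hom_ext (LinearMap.ext fun q => ?_)
  change ∑ j, relations M q j • z j
    = ∑ i, q i • (a • z i - ∑ j, ofPowerSeries (M i j) • z j)
  simp only [relations_apply, sub_smul, smul_sub, Finset.sum_smul, Finset.smul_sum, mul_smul,
    Finset.sum_sub_distrib]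
  rw [Finset.sum_comm]

variable {F : ModuleCat.{0} ATilde} (e : Module.Basis ι ℂ⟦X⟧ (forgetA.obj F))

/-- The matrix of the action of `a` in a `ℂ⟦b⟧`-basis. -/
def actionMatrix (i j : ι) : ℂ⟦X⟧ := e.repr ((AAction.ofModule F).a (e i)) j

theorem sum_actionMatrix_smul (i : ι) :
    ∑ j, actionMatrix e i j • e j = (AAction.ofModule F).a (e i) :=
  e.sum_repr _

/-- The complex `0 → Ã^ι → Ã^ι → F → 0` given by the matrix of `a` in a `ℂ⟦b⟧`-basis of `F`. -/
abbrev presentation : ShortComplex (ModuleCat.{0} ATilde) :=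
  ShortComplex.mk (ModuleCat.ofHom (relations (actionMatrix e)))
    (rowMap (G := F) fun i => e i) <| by
    refine (relations_comp_rowMap (G := F) _ _).trans ?_
    refine ModuleCat.hom_ext (LinearMap.ext fun q => Finset.sum_eq_zero fun i _ => ?_)
    have h : (∑ j, ofPowerSeries (actionMatrix e i j) • (e j : F) : F) = a • (e i : F) :=
      sum_actionMatrix_smul e i
    exact (congrArg (q i • ·) (sub_eq_zero.mpr h.symm)).trans (smul_zero _)

/-- Exactness in the middle is division with remainder: a relation between the basis vectors with
coefficients in `ℂ⟦b⟧` is trivial, so a row vector that maps to `0` has remainder `0`. -/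
theorem presentation_shortExact : (presentation e).ShortExact := by
  have hr : ∀ r : ι → ℂ⟦X⟧, (rowMap (G := F) fun i => e i).hom (fun j => ofPowerSeries (r j))
      = (∑ j, r j • e j : forgetA.obj F) := fun r => rfl
  refine ShortComplex.ShortExact.mk' ?_ ?_ ?_
  · rw [ShortComplex.ShortExact.moduleCat_exact_iff_function_exact]
    intro x
    constructor
    · intro hx
      obtain ⟨q, r, rfl⟩ := exists_eq_relations_add (actionMatrix e) x
      have h0 : (presentation e).g.hom (relations (actionMatrix e) q) = 0 :=
        congrArg (fun f => f.hom q) (presentation e).zero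
      have h1 : (∑ j, r j • e j : forgetA.obj F) = 0 := by
        rw [← hr]
        have h2 := map_add (presentation e).g.hom (relations (actionMatrix e) q)
          (fun j => ofPowerSeries (r j))
        exact ((zero_add _).symm.trans (congrArg (· + _) h0.symm)).trans (h2.symm.trans hx)
      have h3 : ∀ j, r j = 0 := Fintype.linearIndependent_iff.mp e.linearIndependent r h1
      refine ⟨q, ?_⟩
      change relations (actionMatrix e) q = _
      ext1 j
      simp [h3]
    · rintro ⟨q, rfl⟩
      exact congrArg (fun f => f.hom q) (presentation e).zero
  · exact (ModuleCat.mono_iff_injective _).mpr (relations_injective _)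
  · refine (ModuleCat.epi_iff_surjective _).mpr fun x => ?_
    exact ⟨fun j => ofPowerSeries (e.repr x j), (hr _).trans (e.sum_repr x)⟩

/-- The resolution of `F` makes `Ext¹(F, Y)` a quotient of `Hom(Ã^ι, Y)`. -/
theorem exists_extClass_comp_eq {Y : ModuleCat.{0} ATilde} (y : Abelian.Ext.{0} F Y 1) :
    ∃ g : ModuleCat.of ATilde (ι → ATilde) ⟶ Y,
      (presentation_shortExact e).extClass.comp (Abelian.Ext.mk₀ g) (add_zero 1) = y := by
  have hP : Projective (presentation e).X₂ :=
    inferInstanceAs (Projective (ModuleCat.of ATilde (ι → ATilde)))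
  obtain ⟨x, hx⟩ := Abelian.Ext.contravariant_sequence_exact₃ (presentation_shortExact e) Y y
    (Abelian.Ext.eq_zero_of_projective _) (n₀ := 0) rfl
  obtain ⟨g, rfl⟩ := (Abelian.Ext.mk₀_bijective _ _).2 x
  exact ⟨g, hx⟩

end Presentation

namespace CategoryTheory.ShortComplex.ShortExact

variable {A B : Type*} [Category A] [Category B] [Abelian A] [Abelian B] [HasExt.{0} A]
  [HasExt.{0} B] {S : ShortComplex A} (hS : S.ShortExact)

theorem extClass_comp_mk₀_eq_zero_iff {Y : A} (g : S.X₁ ⟶ Y) :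
    hS.extClass.comp (Abelian.Ext.mk₀ g) (add_zero 1) = 0 ↔ ∃ h : S.X₂ ⟶ Y, S.f ≫ h = g := by
  constructor
  · intro h0
    obtain ⟨x, hx⟩ := Abelian.Ext.contravariant_sequence_exact₁ hS Y _ (add_zero 1) h0
    obtain ⟨h, rfl⟩ := (Abelian.Ext.mk₀_bijective _ _).2 x
    rw [Abelian.Ext.mk₀_comp_mk₀] at hx
    exact ⟨h, (Abelian.Ext.mk₀_bijective _ _).1 hx⟩
  · rintro ⟨h, rfl⟩
    rw [← Abelian.Ext.mk₀_comp_mk₀, hS.extClass_comp_assoc]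

include hS in
theorem extClass_eq_zero_of_section (σ : S.X₃ ⟶ S.X₂) (hσ : σ ≫ S.g = 𝟙 _) : hS.extClass = 0 := by
  rw [← Abelian.Ext.mk₀_id_comp hS.extClass, ← hσ, ← Abelian.Ext.mk₀_comp_mk₀_assoc,
    hS.comp_extClass, Abelian.Ext.comp_zero]

variable (Φ : A ⥤ B) [Φ.Additive] [Limits.PreservesFiniteLimits Φ]
  [Limits.PreservesFiniteColimits Φ]

theorem mapExactFunctor_extClass_comp_mk₀_eq_zero_iff {Y : A} (g : S.X₁ ⟶ Y) :
    (hS.extClass.comp (Abelian.Ext.mk₀ g) (add_zero 1)).mapExactFunctor Φ = 0 ↔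
      ∃ h : Φ.obj S.X₂ ⟶ Φ.obj Y, Φ.map S.f ≫ h = Φ.map g := by
  rw [Abelian.Ext.mapExactFunctor_comp, Abelian.Ext.mapExactFunctor_extClass,
    Abelian.Ext.mapExactFunctor_mk₀]
  exact (hS.map_of_exact Φ).extClass_comp_mk₀_eq_zero_iff _

theorem mapExactFunctor_extClass_eq_zero_of_section (σ : Φ.obj S.X₃ ⟶ Φ.obj S.X₂)
    (hσ : σ ≫ Φ.map S.g = 𝟙 _) : hS.extClass.mapExactFunctor Φ = 0 := by
  rw [Abelian.Ext.mapExactFunctor_extClass]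
  exact (hS.map_of_exact Φ).extClass_eq_zero_of_section σ hσ

end CategoryTheory.ShortComplex.ShortExact

/-! ### Reduction modulo a power of `b` -/

/-- The projection `E → E / b ^ N * E`. -/
def toTruncation (N : ℕ) (E : ModuleCat.{0} ATilde) : E ⟶ (truncation N).obj E :=
  ModuleCat.ofHom (bPowSubmodule N E).mkQ

theorem toTruncation_eq_zero_iff (N : ℕ) {E : ModuleCat.{0} ATilde} (x : E) :
    (toTruncation N E).hom x = 0 ↔ ∃ y : E, x = b ^ N • y :=
  Submodule.Quotient.mk_eq_zero _

theorem toTruncation_surjective (N : ℕ) (E : ModuleCat.{0} ATilde) :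
    Function.Surjective (toTruncation N E).hom :=
  Submodule.mkQ_surjective _

theorem b_pow_smul_truncation (N : ℕ) {E : ModuleCat.{0} ATilde} (x : (truncation N).obj E) :
    b ^ N • x = 0 := by
  obtain ⟨y, rfl⟩ := toTruncation_surjective N E x
  rw [← map_smul, toTruncation_eq_zero_iff]
  exact ⟨y, rfl⟩

instance (N : ℕ) (E : ModuleCat.{0} ATilde) : Epi (toTruncation N E) :=
  (ModuleCat.epi_iff_surjective _).mpr (toTruncation_surjective N E)

theorem exists_toTruncation_comp_eq (N : ℕ) {J E : ModuleCat.{0} ATilde}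
    (g : J ⟶ (truncation N).obj E) :
    ∃ g' : (truncation N).obj J ⟶ (truncation N).obj E, toTruncation N J ≫ g' = g := by
  refine ⟨ModuleCat.ofHom ((bPowSubmodule N J).liftQ g.hom ?_), ?_⟩
  · rintro _ ⟨y, rfl⟩
    exact (map_smul g.hom (b ^ N) y).trans (b_pow_smul_truncation N _)
  · refine ModuleCat.hom_ext (LinearMap.ext fun x => rfl)

/-- The morphism from a short complex to its reduction modulo `b ^ N`. -/
def toTruncationMap (N : ℕ) (S : ShortComplex (ModuleCat.{0} ATilde)) :
    S ⟶ S.map (truncation N) where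
  τ₁ := toTruncation N S.X₁
  τ₂ := toTruncation N S.X₂
  τ₃ := toTruncation N S.X₃
  comm₁₂ := rfl
  comm₂₃ := rfl

theorem IsABModule.b_pow_smul_eq_zero {F : ModuleCat.{0} ATilde} (hF : IsABModule F) (N : ℕ) {x : F}
    (hx : b ^ N • x = 0) : x = 0 := by
  have := hF.free
  rw [← ofPowerSeries_X_pow] at hx
  exact (smul_eq_zero (R := ℂ⟦X⟧) (M := forgetA.obj F)).mp hx |>.resolve_left
    (pow_ne_zero _ PowerSeries.X_ne_zero)

/-- The complex `0 → b ^ N * F → F → F / b ^ N * F → 0`. -/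
abbrev bPowSequence (N : ℕ) (F : ModuleCat.{0} ATilde) : ShortComplex (ModuleCat.{0} ATilde) :=
  ShortComplex.mk (ModuleCat.ofHom (bPowSubmodule N F).subtype) (toTruncation N F) <|
    ModuleCat.hom_ext (LinearMap.ext fun x => (toTruncation_eq_zero_iff N _).mpr x.2)

theorem bPowSequence_shortExact (N : ℕ) (F : ModuleCat.{0} ATilde) :
    (bPowSequence N F).ShortExact := by
  refine ShortComplex.ShortExact.mk' ?_ ?_ ?_
  · rw [ShortComplex.ShortExact.moduleCat_exact_iff_function_exact]
    intro x
    refine (toTruncation_eq_zero_iff N _).trans ⟨fun h => ⟨⟨x, h⟩, rfl⟩, ?_⟩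
    rintro ⟨y, rfl⟩
    exact y.2
  · exact (ModuleCat.mono_iff_injective _).mpr Subtype.val_injective
  · exact inferInstanceAs (Epi (toTruncation N F))

/-- A `ℂ⟦b⟧`-linear map to a module killed by `b ^ N` kills `b ^ N * F`. -/
theorem bPowSequence_f_comp_eq_zero (N : ℕ) {F Y : ModuleCat.{0} ATilde}
    (h : forgetA.obj F ⟶ forgetA.obj ((truncation N).obj Y)) :
    forgetA.map (bPowSequence N F).f ≫ h = 0 := by
  refine ModuleCat.hom_ext (LinearMap.ext ?_)
  rintro ⟨_, y, rfl⟩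
  have h1 : h.hom (b ^ N • y : F) = (b ^ N • h.hom y : (truncation N).obj Y) := by
    rw [← ofPowerSeries_X_pow]
    exact map_smul h.hom (PowerSeries.X ^ N : ℂ⟦X⟧) (show forgetA.obj F from y)
  exact h1.trans (b_pow_smul_truncation N _)

section ShortExact

variable {S : ShortComplex (ModuleCat.{0} ATilde)} (hS : S.ShortExact) (hF : IsABModule S.X₃)
  (N : ℕ)
include hS hF

/-- Reduction modulo `b ^ N` keeps an extension of `F` exact, because `F` has no `b`-torsion. -/
theorem shortExact_map_truncation : (S.map (truncation N)).ShortExact := by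
  have hinj : Function.Injective S.f.hom := (ModuleCat.mono_iff_injective _).mp hS.mono_f
  have hsurj : Function.Surjective S.g.hom := (ModuleCat.epi_iff_surjective _).mp hS.epi_g
  have hex : Function.Exact S.f.hom S.g.hom :=
    (ShortComplex.ShortExact.moduleCat_exact_iff_function_exact S).mp hS.exact
  have hf : ∀ x, ((truncation N).map S.f).hom ((toTruncation N _).hom x)
    = (toTruncation N _).hom (S.f.hom x) := fun _ => rfl
  have hg : ∀ x, ((truncation N).map S.g).hom ((toTruncation N _).hom x)
    = (toTruncation N _).hom (S.g.hom x) := fun _ => rfl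
  refine ShortComplex.ShortExact.mk' ?_ ?_ ?_
  · rw [ShortComplex.ShortExact.moduleCat_exact_iff_function_exact]
    intro x
    obtain ⟨x, rfl⟩ := toTruncation_surjective N _ x
    constructor
    · intro hx
      obtain ⟨z, hz⟩ := (toTruncation_eq_zero_iff N _).mp ((hg x).symm.trans hx)
      obtain ⟨y, rfl⟩ := hsurj z
      obtain ⟨t, ht⟩ := (hex (x - b ^ N • y)).mp (by rw [map_sub, map_smul, hz, sub_self])
      refine ⟨(toTruncation N _).hom t, (hf t).trans ?_⟩
      rw [ht, map_sub, sub_eq_self, toTruncation_eq_zero_iff]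
      exact ⟨y, rfl⟩
    · rintro ⟨y, hy⟩
      obtain ⟨y, rfl⟩ := toTruncation_surjective N _ y
      rw [← hy]
      refine (congrArg _ (hf y)).trans ((hg _).trans ?_)
      rw [(hex _).mpr ⟨y, rfl⟩, map_zero]
      rfl
  · refine (ModuleCat.mono_iff_injective _).mpr ((injective_iff_map_eq_zero _).mpr fun x hx => ?_)
    obtain ⟨x, rfl⟩ := toTruncation_surjective N _ x
    obtain ⟨y, hy⟩ := (toTruncation_eq_zero_iff N _).mp ((hf x).symm.trans hx)
    have hy0 : S.g.hom y = 0 := hF.b_pow_smul_eq_zero N (by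
      rw [← map_smul, ← hy]
      exact (hex _).mpr ⟨x, rfl⟩)
    obtain ⟨t, rfl⟩ := (hex y).mp hy0
    rw [← map_smul] at hy
    exact (toTruncation_eq_zero_iff N _).mpr ⟨t, hinj hy⟩
  · refine (ModuleCat.epi_iff_surjective _).mpr fun x => ?_
    obtain ⟨x, rfl⟩ := toTruncation_surjective N _ x
    obtain ⟨y, rfl⟩ := hsurj x
    exact ⟨(toTruncation N _).hom y, hg y⟩

/-- The pull-back of the reduced extension to `F` is the push-out of the original extension to
`E / b ^ N * E`. -/
theorem toTruncation_comp_extClass :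
    (Abelian.Ext.mk₀ (toTruncation N S.X₃)).comp
        (shortExact_map_truncation hS hF N).extClass (zero_add 1)
      = hS.extClass.comp (Abelian.Ext.mk₀ (toTruncation N S.X₁)) (add_zero 1) :=
  (ShortComplex.ShortExact.extClass_naturality hS (shortExact_map_truncation hS hF N)
    (toTruncationMap N S)).symm

/-- The reduction of an extension of `F` splits over `ℂ⟦b⟧`, because the extension itself does. -/
theorem extClass_mem_kerForget :
    (shortExact_map_truncation hS hF N).extClass
      ∈ kerForget ((truncation N).obj S.X₃) ((truncation N).obj S.X₁) := by
  have hT := shortExact_map_truncation hS hF N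
  have := hF.free
  have : Module.Projective ℂ⟦X⟧ (forgetA.obj S.X₃) := Module.Projective.of_free
  let g₀ : forgetA.obj S.X₂ →ₗ[ℂ⟦X⟧] forgetA.obj S.X₃ := (forgetA.map S.g).hom
  have hsurj : Function.Surjective g₀ :=
    (ModuleCat.epi_iff_surjective (R := ATilde) S.g).mp hS.epi_g
  obtain ⟨σ, hσ⟩ := Module.projective_lifting_property g₀ LinearMap.id hsurj
  have hB := (bPowSequence_shortExact N S.X₃).map_of_exact forgetA
  have := hB.epi_g
  -- a `ℂ⟦b⟧`-linear section of the extension descends to the reduction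
  let k : forgetA.obj S.X₃ ⟶ forgetA.obj ((truncation N).obj S.X₂) :=
    ModuleCat.ofHom (X := forgetA.obj S.X₃) (Y := forgetA.obj S.X₂) σ ≫
      forgetA.map (toTruncation N S.X₂)
  have hk : forgetA.map (bPowSequence N S.X₃).f ≫ k = 0 := bPowSequence_f_comp_eq_zero N k
  let σN : forgetA.obj ((truncation N).obj S.X₃) ⟶ forgetA.obj ((truncation N).obj S.X₂) :=
    hB.exact.desc k hk
  have hσN : σN ≫ forgetA.map ((truncation N).map S.g) = 𝟙 _ := by
    have h1 : forgetA.map (toTruncation N S.X₃) ≫ σN = k := hB.exact.g_desc k hk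
    have : Epi (forgetA.map (toTruncation N S.X₃)) := hB.epi_g
    rw [← cancel_epi (forgetA.map (toTruncation N S.X₃)), ← Category.assoc, h1]
    refine ModuleCat.hom_ext (LinearMap.ext fun x => ?_)
    exact congrArg (toTruncation N S.X₃).hom (LinearMap.congr_fun hσ x)
  exact hT.mapExactFunctor_extClass_eq_zero_of_section forgetA σN hσN

end ShortExact

/-! ### The two comparison maps -/

section Comparison

variable {F : ModuleCat.{0} ATilde} (E : ModuleCat.{0} ATilde) (N : ℕ)

/-- Pull-back along `F → F / b ^ N * F`, on the classes that vanish over `ℂ⟦b⟧`. -/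
def pullbackKer : kerForget ((truncation N).obj F) ((truncation N).obj E) →ₗ[ℂ]
    Abelian.Ext.{0} F ((truncation N).obj E) 1 :=
  ((Abelian.Ext.mk₀ (toTruncation N F)).precompOfLinear ℂ ((truncation N).obj E)
    (zero_add 1)).comp (Submodule.subtype _)

/-- A class that dies on `F` comes from a morphism on `b ^ N * F`; when it also vanishes over
`ℂ⟦b⟧`, this morphism extends to `F` over `ℂ⟦b⟧`, so it is zero. -/
theorem pullbackKer_injective : Function.Injective (pullbackKer (F := F) E N) := by
  rw [injective_iff_map_eq_zero]
  rintro ⟨x, hx⟩ h0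
  have hB := bPowSequence_shortExact N F
  obtain ⟨y, hy⟩ := Abelian.Ext.contravariant_sequence_exact₃ hB _ x h0 (n₀ := 0) rfl
  obtain ⟨g, rfl⟩ := (Abelian.Ext.mk₀_bijective _ _).2 y
  subst hy
  obtain ⟨h, hh⟩ := (hB.mapExactFunctor_extClass_comp_mk₀_eq_zero_iff forgetA g).mp hx
  have h2 : forgetA.map g = 0 := hh.symm.trans (bPowSequence_f_comp_eq_zero N h)
  have h3 : g = 0 := forgetA.map_injective (h2.trans (forgetA.map_zero _ _).symm)
  apply Subtype.ext
  subst h3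
  change hB.extClass.comp (Abelian.Ext.mk₀ 0) (add_zero 1) = 0
  rw [Abelian.Ext.mk₀_zero, Abelian.Ext.comp_zero]

theorem pullbackKer_surjective (hF : IsABModule F) :
    Function.Surjective (pullbackKer (F := F) E N) := by
  intro y
  have := hF.free
  have := hF.finite
  let e := Module.Free.chooseBasis ℂ⟦X⟧ (forgetA.obj F)
  obtain ⟨g, rfl⟩ := exists_extClass_comp_eq e y
  obtain ⟨g', rfl⟩ := exists_toTruncation_comp_eq N g
  have hS := presentation_shortExact e
  refine ⟨⟨(shortExact_map_truncation hS hF N).extClass.comp (Abelian.Ext.mk₀ g') (add_zero 1),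
    ?_⟩, ?_⟩
  · refine (Abelian.Ext.mapExactFunctor_comp forgetA _ _ _).trans ?_
    exact (congrArg (fun x => Abelian.Ext.comp x _ _) (extClass_mem_kerForget hS hF N)).trans
      (Abelian.Ext.zero_comp _ _ _ _ (add_zero 1))
  · rw [← Abelian.Ext.mk₀_comp_mk₀]
    refine (Abelian.Ext.comp_assoc_of_third_deg_zero _ _ _ (zero_add 1)).symm.trans ?_
    refine (congrArg (fun x => Abelian.Ext.comp x (Abelian.Ext.mk₀ g') (add_zero 1))
      (toTruncation_comp_extClass hS hF N)).trans ?_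
    exact Abelian.Ext.comp_assoc_of_third_deg_zero _ _ _ _

end Comparison

section Pushout

variable (N : ℕ) (F E : ModuleCat.{0} ATilde)

/-- Push-out of extensions along `E → E / b ^ N * E`. -/
def pushoutTruncation :
    Abelian.Ext.{0} F E 1 →ₗ[ℂ] Abelian.Ext.{0} F ((truncation N).obj E) 1 :=
  (Abelian.Ext.mk₀ (toTruncation N E)).postcompOfLinear ℂ F (add_zero 1)

variable {F}

theorem pushoutTruncation_surjective (hF : IsABModule F) :
    Function.Surjective (pushoutTruncation N F E) := by
  intro y
  have := hF.free
  have := hF.finite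
  let e := Module.Free.chooseBasis ℂ⟦X⟧ (forgetA.obj F)
  obtain ⟨g, rfl⟩ := exists_extClass_comp_eq e y
  refine ⟨(presentation_shortExact e).extClass.comp
    (Abelian.Ext.mk₀ (Projective.factorThru g (toTruncation N E))) (add_zero 1), ?_⟩
  refine (Abelian.Ext.comp_assoc_of_third_deg_zero _ _ _ _).trans ?_
  rw [Abelian.Ext.mk₀_comp_mk₀, Projective.factorThru_comp]

/-- A class in the kernel is given by a `ℂ⟦b⟧`-linear map `b ^ N * φ : F → E`; it is trivial when
this map is the commutator of `a` with a `ℂ⟦b⟧`-linear map `ψ`. -/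
theorem pushoutTruncation_injective (hF : IsABModule F)
    (h : ∀ φ : forgetA.obj F →ₗ[ℂ⟦X⟧] forgetA.obj E, ∃ ψ : forgetA.obj F →ₗ[ℂ⟦X⟧] forgetA.obj E,
      ∀ x, (AAction.ofModule E).a (ψ x) - ψ ((AAction.ofModule F).a x)
        = (PowerSeries.X ^ N : ℂ⟦X⟧) • φ x) :
    Function.Injective (pushoutTruncation N F E) := by
  classical
  rw [injective_iff_map_eq_zero]
  intro x hx
  have := hF.free
  have := hF.finite
  let e := Module.Free.chooseBasis ℂ⟦X⟧ (forgetA.obj F)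
  have hS := presentation_shortExact e
  obtain ⟨g, rfl⟩ := exists_extClass_comp_eq e x
  have h0 : hS.extClass.comp (Abelian.Ext.mk₀ (g ≫ toTruncation N E)) (add_zero 1) = 0 := by
    rw [← Abelian.Ext.mk₀_comp_mk₀]
    exact (Abelian.Ext.comp_assoc_of_third_deg_zero _ _ _ _).symm.trans hx
  obtain ⟨k, hk⟩ := (hS.extClass_comp_mk₀_eq_zero_iff _).mp h0
  -- subtracting a morphism that extends, `g` may be taken to have values in `b ^ N * E`
  let k' : ModuleCat.of ATilde (Module.Free.ChooseBasisIndex ℂ⟦X⟧ (forgetA.obj F) → ATilde) ⟶ E :=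
    Projective.factorThru k (toTruncation N E)
  have hk' : k' ≫ toTruncation N E = k := Projective.factorThru_comp _ _
  let g₁ := g - (presentation e).f ≫ k'
  have hg₁ : g₁ ≫ toTruncation N E = 0 := by
    rw [Preadditive.sub_comp, Category.assoc, hk', sub_eq_zero]
    exact hk.symm
  have ht : ∀ i, ∃ t : E, g₁.hom (Pi.single i 1) = b ^ N • t := fun i =>
    (toTruncation_eq_zero_iff N _).mp (congrArg (fun f => f.hom (Pi.single i 1)) hg₁)
  choose t ht using ht
  let t' : Module.Free.ChooseBasisIndex ℂ⟦X⟧ (forgetA.obj F) → forgetA.obj E := t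
  obtain ⟨ψ, hψ⟩ := h (e.constr ℂ⟦X⟧ t')
  have hg₁' : (presentation e).f ≫ rowMap (G := E) (fun i => ψ (e i)) = g₁ := by
    refine (relations_comp_rowMap (G := E) _ _).trans
      ((congrArg rowMap ?_).trans (eq_rowMap g₁).symm)
    ext1 i
    have h1 := hψ (e i)
    rw [← sum_actionMatrix_smul, map_sum, e.constr_basis] at h1
    simp only [map_smul] at h1
    refine Eq.trans h1 (Eq.trans ?_ (ht i).symm)
    rw [← ofPowerSeries_X_pow]
    rfl
  refine (hS.extClass_comp_mk₀_eq_zero_iff g).mpr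
    ⟨k' + rowMap (G := E) (fun i => ψ (e i)), ?_⟩
  rw [Preadditive.comp_add, hg₁']
  exact add_sub_cancel _ _

end Pushout

end

theorem mainTheorem4 (F : ModuleCat.{0} ATilde) (hF : IsABModule F) (lam : ℂ) :
    ((dualAction F).bounds (-lam)).Nonempty ∧
    ∀ N : ℕ, (dualAction F).leastBound (-lam) ≤ N →
      ∃ δ : Abelian.Ext.{0} F (ELam lam) 1 ≃ₗ[ℂ]
          kerForget ((truncation N).obj F) ((truncation N).obj (ELam lam)),
        ∀ (E : ModuleCat.{0} ATilde) (α : ELam lam ⟶ E) (β : E ⟶ F) (w : α ≫ β = 0)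
          (hS : (ShortComplex.mk α β w).ShortExact),
          ∃ hT : ((ShortComplex.mk α β w).map (truncation N)).ShortExact,
            (δ hS.extClass : Abelian.Ext.{0} ((truncation N).obj F)
              ((truncation N).obj (ELam lam)) 1) = hT.extClass := by
  have := isNoetherian_dual F hF
  refine ⟨(dualAction F).bounds_nonempty (-lam), fun N hN => ?_⟩
  let u := LinearEquiv.ofBijective (pushoutTruncation N F (ELam lam))
    ⟨pushoutTruncation_injective N _ hF (exists_commutator_eq F hF lam hN),
      pushoutTruncation_surjective N _ hF⟩
  let v := LinearEquiv.ofBijective (pullbackKer (F := F) (ELam lam) N)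
    ⟨pullbackKer_injective _ N, pullbackKer_surjective _ N hF⟩
  refine ⟨u.trans v.symm, fun E α β w hS => ⟨shortExact_map_truncation hS hF N, ?_⟩⟩
  have h : v.symm (u hS.extClass)
      = ⟨(shortExact_map_truncation hS hF N).extClass, extClass_mem_kerForget hS hF N⟩ :=
    v.symm_apply_eq.mpr (toTruncation_comp_extClass hS hF N).symm
  exact congrArg Subtype.val h
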